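/- **Setting.** Let $\mathcal A=\{1,\dots,m\}$. A substitution $\zeta$ assigns to every letter a non-empty finite word over $\mathcal A$ and is extended to words and to two-sided sequences by concatenation (for two-sided sequences, $\zeta(\dots x_{-1}.x_0x_1\dots)=\dots\zeta(x_{-1}).\zeta(x_0)\zeta(x_1)\dots$); its matrix $\mathsf S_\zeta$ has as $(i,j)$ entry the number of symbols $i$ in $\zeta(j)$. Let $\mathfrak A$ be the class of substitutions for which every letter occurs in some $\zeta(b)$ and $|\zeta(b)|>1$ for some $b$. Let $\mathbf a=(\zeta_n)_{n\ge1}$ be a sequence in $\mathfrak A$; put $\zeta^{[n]}=\zeta_1\circ\dots\circ\zeta_n$, $\mathsf S_n=\mathsf S_{\zeta_n}$, $\mathsf S^{[n]}=\mathsf S_{\zeta^{[n]}}=\mathsf S_1\cdots\mathsf S_n$ (with $\mathsf S^{[0]}=I$). Let $X_{\mathbf a}\subset\mathcal A^{\mathbb Z}$ be the set of two-sided sequences each of whose subwords is a subword of $\zeta^{[n]}(b)$ for some $n\ge1$, $b\in\mathcal A$, and let $T$ be the left shift. Assume: - **(A1′)** there is a finite word $\mathbf q=q_1\dots q_k$ of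 substitutions such that $\mathsf S_{q_1}\cdots\mathsf S_{q_k}$ has strictly positive entries and, for every $\varepsilon>0$, for all sufficiently large $n$ the word $\mathbf q$ occurs as a subword of $\zeta_{\lfloor n(1-\varepsilon)\rfloor+1},\dots,\zeta_n$ (when $\varepsilon>1$, of $\zeta_1,\dots,\zeta_n$); - **(A2)** the limit $\lambda_{\mathbf a}=\lim_{n\to\infty}\frac1n\log\|\mathsf S^{[n]}\|$ exists and is finite; - **(A3)** $\lim_{n\to\infty}\frac1n\log(1+\|\mathsf S_n\|)=0$; - $X_{\mathbf a}$ contains no $T$-periodic point; - $\mathbf a$ is recognizable: for every $n\ge1$ and $x\in X_{\mathbf a}$, the representation $x=T^k(\zeta^{[n]}(x'))$ with $x'\in X_{(\zeta_{n+1},\zeta_{n+2},\dots)}$ and $0\le k<|\zeta^{[n]}(x'_0)|$ is unique. Let $\vec s\in\mathbb R^m$ have positive entries and let $\mu$ be the $T$-invariant Borel probability measure on $X_{\mathbf a}$ (under these assumptions it is unique). Let $(\mathfrak X_{\mathbf a}^{\vec s},h_t,\widetilde\mu)$ be the suspension flow over $(X_{\mathbf a},T,\mu)$ with roof function $x\mapsto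 s_{x_0}$, that is, the unit speed vertical flow on $\{(x,t):x\in X_{\mathbf a},\ 0\le t<s_{x_0}\}$ with $(x,s_{x_0})$ identified with $(Tx,0)$; $\widetilde\mu$ is the restriction of $\mu\times$ Lebesgue. For $\vec b\in\mathbb C^m$ the *simple cylindrical function* corresponding to $\vec b$ is $f(x,t)=b_{x_0}$. The *spectral measure* $\sigma_f$ is the finite positive Borel measure on $\mathbb R$ with $\int e^{2\pi i\omega t}\,d\sigma_f(\omega)=\int (f\circ h_t)\,\overline f\,d\widetilde\mu$ for all $t\in\mathbb R$, and the *lower local dimension* of a finite measure $\nu$ on $\mathbb R$ is $\underline d(\nu,\omega)=\liminf_{r\to0+}\frac{\log\nu((\omega-r,\omega+r))}{\log r}$. For a substitution $\zeta$ with $\zeta(b)=u_1^b\dots u^b_{|\zeta(b)|}$ and $\xi\in\mathbb R^m$, let $\mathscr M_\zeta(\xi)$ be the complex $m\times m$ matrix with entries $$\mathscr M_\zeta(\xi)_{b,c}=\sum_{j\le|\zeta(b)|,\ u_j^b=c}\exp\Bigl(-2\pi i\sum_{k=1}^{j-1}\xi_{u_k^b}\Bigr),$$ and let $\mathscr M_{\mathbf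 a}(\xi,n)=\mathscr M_{\zeta_n}\bigl((\mathsf S^{[n-1]})^t\xi\bigr)\cdots\mathscr M_{\zeta_2}\bigl((\mathsf S^{[1]})^t\xi\bigr)\mathscr M_{\zeta_1}(\xi)$. Define, with values in $[-\infty,\infty]$ and $\log0=-\infty$, $$\chi^+_{\mathbf a,\xi}=\limsup_{n\to\infty}\tfrac1n\log\|\mathscr M_{\mathbf a}(\xi,n)\|,\qquad \chi^+_{\mathbf a,\xi,\vec z}=\limsup_{n\to\infty}\tfrac1n\log\|\mathscr M_{\mathbf a}(\xi,n)\vec z\|\quad(\vec z\in\mathbb C^m).$$ For $\omega\ne0$ let $\Gamma_\omega\vec b=\Bigl(\frac{b_a(1-e^{-2\pi i\omega s_a})}{2\pi i\omega}\Bigr)_{a\in\mathcal A}$, and let $\vec e_j$ be the $j$-th unit coordinate vector. **Corollary 4.3.** Under these assumptions: (i) Let $\omega\in\mathbb R\setminus\bigcup_{a\in\mathcal A}s_a^{-1}\mathbb Z$. For every $\vec b\in\mathbb C^m$ there is $j\le m$ such that $$\operatorname{card}\bigl\{c\in\mathbb C:\ \chi^+_{\mathbf a,\omega\vec s,\,\Gamma_\omega(\vec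 b+c\vec e_j)}<\chi^+_{\mathbf a,\omega\vec s}\bigr\}\le1,$$ and, if $\chi^+_{\mathbf a,\omega\vec s}>0$, then for every $c\in\mathbb C$ outside this set the simple cylindrical function $f$ corresponding to $\vec b+c\vec e_j$ satisfies $$\underline d(\sigma_f,\omega)=2-\frac{2\chi^+_{\mathbf a,\omega\vec s}}{\lambda_{\mathbf a}}.$$ (ii) For Lebesgue-a.e. $\vec b\in\mathbb C^m$, the simple cylindrical function $f$ corresponding to $\vec b$ satisfies $$\underline d(\sigma_f,\omega)=2-\frac{2\chi^+_{\mathbf a,\omega\vec s}}{\lambda_{\mathbf a}}$$ for Lebesgue-a.e. $\omega\in\mathbb R$ such that $\chi^+_{\mathbf a,\omega\vec s}>0$. -/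

import Mathlib

open MeasureTheory Filter Topology
open scoped ENNReal NNReal Matrix

noncomputable section

namespace SAdic

variable {m : ℕ}

/-! ## Substitutions -/

/-- A substitution on the alphabet `Fin m`: every letter is sent to a non-empty finite word. -/
structure Substitution (m : ℕ) where
  word : Fin m → List (Fin m)
  word_ne_nil : ∀ b, word b ≠ []

namespace Substitution

/-- The identity substitution `b ↦ b`. -/
def one (m : ℕ) : Substitution m where
  word b := [b]
  word_ne_nil _ := by simp

/-- The composition `ζ ∘ η`: the word `η b` is read off and `ζ` is applied by concatenation. -/
def comp (ζ η : Substitution m) : Substitution m where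
  word b := (η.word b).flatMap ζ.word
  word_ne_nil b := by
    obtain ⟨c, hc⟩ := List.exists_mem_of_ne_nil _ (η.word_ne_nil b)
    intro h
    exact ζ.word_ne_nil c (List.flatMap_eq_nil_iff.mp h c hc)

/-- The substitution matrix: the `(i, j)` entry is the number of symbols `i` in the word `ζ j`. -/
def mat (ζ : Substitution m) : Matrix (Fin m) (Fin m) ℕ :=
  Matrix.of fun i j => (ζ.word j).count i

/-- The class `𝔄` of substitutions: all letters occur in the words `ζ b`, and some word `ζ b` has
length greater than one. -/
def InClass (ζ : Substitution m) : Prop :=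
  (∀ c, ∃ b, c ∈ ζ.word b) ∧ ∃ b, 1 < (ζ.word b).length

/-- The matrix-valued trigonometric polynomial `𝓜_ζ(ξ)`: if `ζ b = u₁ … u_N`, its `(b, c)` entry is
the sum of `exp (-2πi (ξ_{u₁} + … + ξ_{u_{j-1}}))` over all `j` with `u_j = c`. -/
def spectralMat (ζ : Substitution m) (ξ : Fin m → ℝ) : Matrix (Fin m) (Fin m) ℂ :=
  Matrix.of fun b c => ∑ j : Fin (ζ.word b).length,
    if (ζ.word b)[j] = c then
      Complex.exp (-2 * Real.pi * Complex.I * ((((ζ.word b).take j).map ξ).sum : ℝ))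
    else 0

end Substitution

/-- `prodSub a n = ζ^{[n]} = ζ₁ ∘ ⋯ ∘ ζₙ`, where the sequence `ζ₁, ζ₂, …` is stored as
`a 0, a 1, …`, that is, `a n = ζ_{n+1}`. -/
def prodSub (a : ℕ → Substitution m) : ℕ → Substitution m
  | 0 => Substitution.one m
  | n + 1 => (prodSub a n).comp (a n)

/-! ## The two-sided `S`-adic shift -/

/-- The `n`-th power of the left shift on two-sided sequences. -/
def shift (n : ℤ) (x : ℤ → Fin m) : ℤ → Fin m := fun j => x (j + n)

/-- The `S`-adic space `X_a`: all two-sided sequences each of whose subwords is a subword of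
`ζ^{[n]}(b)` for some letter `b` and some `n ≥ 1`. -/
def space (a : ℕ → Substitution m) : Set (ℤ → Fin m) :=
  {x | ∀ (i : ℤ) (L : ℕ), ∃ n, 1 ≤ n ∧ ∃ b,
    (List.ofFn fun k : Fin L => x (i + (k : ℤ))) <:+: (prodSub a n).word b}

/-- No point of `X_a` is periodic under the shift. -/
def Aperiodic (a : ℕ → Substitution m) : Prop :=
  ∀ x ∈ space a, ∀ p : ℕ, 0 < p → shift p x ≠ x

/-- The additive cocycle of a function `g` of the zeroth letter along a two-sided sequence:
`∑_{0 ≤ k < n} g (x k)` for `n ≥ 0` and `-∑_{n ≤ k < 0} g (x k)` for `n < 0`. -/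
def cocycleSum {G : Type*} [AddCommGroup G] (g : Fin m → G) (x : ℤ → Fin m) (n : ℤ) : G :=
  ∑ k ∈ Finset.Ico 0 n, g (x k) - ∑ k ∈ Finset.Ico n 0, g (x k)

/-- `IsImage ζ x y` says `y = ζ(x)` for two-sided sequences:
`y = … ζ(x₋₁) . ζ(x₀) ζ(x₁) …`, with the word `ζ(x₀)` starting at coordinate `0`. -/
def IsImage (ζ : Substitution m) (x y : ℤ → Fin m) : Prop :=
  ∀ (n : ℤ) (i : Fin (ζ.word (x n)).length),
    y (cocycleSum (fun c => ((ζ.word c).length : ℤ)) x n + (i : ℕ)) = (ζ.word (x n))[i]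

/-- `x = T^k (ζ^{[n]}(x'))` with `x'` in the space of the sequence `ζ_{n+1}, ζ_{n+2}, …` and
`0 ≤ k < |ζ^{[n]}(x'₀)|`. -/
def IsRepresentation (a : ℕ → Substitution m) (n : ℕ) (x : ℤ → Fin m)
    (k : ℕ) (x' : ℤ → Fin m) : Prop :=
  x' ∈ space (fun i => a (i + n)) ∧ k < ((prodSub a n).word (x' 0)).length ∧
    ∃ y, IsImage (prodSub a n) x' y ∧ x = shift k y

/-- Recognizability: for every `n ≥ 1`, the representation of a point of `X_a` as
`T^k (ζ^{[n]}(x'))` is unique. -/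
def Recognizable (a : ℕ → Substitution m) : Prop :=
  ∀ n, 1 ≤ n → ∀ x ∈ space a, ∀ (k l : ℕ) (x' y' : ℤ → Fin m),
    IsRepresentation a n x k x' → IsRepresentation a n x l y' → k = l ∧ x' = y'

/-! ## Norms, growth conditions and Lyapunov exponents -/

/-- The matrix `1`-norm (maximal absolute column sum). -/
def matNorm {𝕜 : Type*} [NormedField 𝕜] (A : Matrix (Fin m) (Fin m) 𝕜) : ℝ≥0 :=
  Finset.univ.sup fun j => ∑ i, ‖A i j‖₊

/-- The `1`-norm on `ℂ^m`. -/
def vecNorm (z : Fin m → ℂ) : ℝ≥0 := ∑ i, ‖z i‖₊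

/-- The substitution matrix with real entries. -/
def realMat (ζ : Substitution m) : Matrix (Fin m) (Fin m) ℝ := ζ.mat.map (fun k : ℕ => (k : ℝ))

/-- Condition (A1'): there is a finite word `q = q₁ … q_k` of substitutions such that the matrix
`S_q = S_{q₁} ⋯ S_{q_k}` is strictly positive and, for every `ε > 0` and all large `n`, the word `q`
occurs in `ζ_{⌊n(1-ε)⌋+1}, …, ζ_n`, i.e. in `a ⌊n(1-ε)⌋, …, a (n-1)`. -/
def CondA1' (a : ℕ → Substitution m) : Prop :=
  ∃ q : List (Substitution m), (∀ i j, 0 < (q.map Substitution.mat).prod i j) ∧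
    ∀ ε : ℝ, 0 < ε → ∃ n₀ : ℕ, ∀ n, n₀ ≤ n →
      ∃ i, ⌊(n : ℝ) * (1 - ε)⌋₊ ≤ i ∧ i + q.length ≤ n ∧
        ∀ k : Fin q.length, a (i + k) = q[k]

/-- Condition (A2): `lam` is the limit of `n⁻¹ log ‖S^{[n]}‖`. -/
def CondA2 (a : ℕ → Substitution m) (lam : ℝ) : Prop :=
  Tendsto (fun n : ℕ => Real.log (matNorm (realMat (prodSub a n))) / n) atTop (𝓝 lam)

/-- Condition (A3): `n⁻¹ log (1 + ‖Sₙ‖)` tends to zero; here `Sₙ` is the matrix of `a (n-1)`. -/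
def CondA3 (a : ℕ → Substitution m) : Prop :=
  Tendsto (fun n : ℕ => Real.log (1 + matNorm (realMat (a n))) / ((n : ℝ) + 1)) atTop (𝓝 0)

/-- The spectral cocycle
`𝓜_a(ξ, n) = 𝓜_{ζₙ}((S^{[n-1]})ᵗ ξ) ⋯ 𝓜_{ζ₂}((S_{ζ₁})ᵗ ξ) 𝓜_{ζ₁}(ξ)`.
It is `ℤ^m`-periodic in `ξ`. -/
def cocycle (a : ℕ → Substitution m) (ξ : Fin m → ℝ) : ℕ → Matrix (Fin m) (Fin m) ℂ
  | 0 => 1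
  | n + 1 => (a n).spectralMat ((realMat (prodSub a n))ᵀ *ᵥ ξ) * cocycle a ξ n

/-- The pointwise upper Lyapunov exponent `limsup n⁻¹ log ‖𝓜_a(ξ, n)‖`, in `[-∞, ∞]`. -/
def lyap (a : ℕ → Substitution m) (ξ : Fin m → ℝ) : EReal :=
  limsup (fun n : ℕ => ENNReal.log (matNorm (cocycle a ξ n)) / (n : EReal)) atTop

/-- The pointwise upper Lyapunov exponent `limsup n⁻¹ log ‖𝓜_a(ξ, n) z‖` in the direction of the
vector `z`, in `[-∞, ∞]` (with `log 0 = -∞`). -/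
def lyapVec (a : ℕ → Substitution m) (ξ : Fin m → ℝ) (z : Fin m → ℂ) : EReal :=
  limsup (fun n : ℕ => ENNReal.log (vecNorm (cocycle a ξ n *ᵥ z)) / (n : EReal)) atTop

/-- The vector `Γ_ω b` of Fourier transforms `b_j (1 - e^{-2πiω s_j}) / (2πiω)` of the functions
`b_j 1_{[0, s_j]}`; for `ω = 0` the convention is `Γ_0 b = b`. -/
def Gam (s : Fin m → ℝ) (ω : ℝ) (b : Fin m → ℂ) : Fin m → ℂ := fun j =>
  if ω = 0 then b j
  else b j * (1 - Complex.exp (-2 * Real.pi * Complex.I * ω * s j)) /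
    (2 * Real.pi * Complex.I * ω)

/-! ## The suspension flow -/

lemma cocycleSum_zero {G : Type*} [AddCommGroup G] (g : Fin m → G) (x : ℤ → Fin m) :
    cocycleSum g x 0 = 0 := by simp [cocycleSum]

lemma cocycleSum_succ {G : Type*} [AddCommGroup G] (g : Fin m → G) (x : ℤ → Fin m) (n : ℤ) :
    cocycleSum g x (n + 1) = cocycleSum g x n + g (x n) := by
  unfold cocycleSum
  rcases le_or_gt 0 n with hn | hn
  · have h1 : Finset.Ico 0 (n + 1) = insert n (Finset.Ico 0 n) := by
      ext k; simp only [Finset.mem_Ico, Finset.mem_insert]; omega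
    have h2 : Finset.Ico (n + 1) 0 = ∅ := Finset.Ico_eq_empty (by omega)
    have h3 : Finset.Ico n 0 = ∅ := Finset.Ico_eq_empty (by omega)
    rw [h1, h2, h3, Finset.sum_insert (by simp)]
    simp [add_comm]
  · have h1 : Finset.Ico n 0 = insert n (Finset.Ico (n + 1) 0) := by
      ext k; simp only [Finset.mem_Ico, Finset.mem_insert]; omega
    have h2 : Finset.Ico 0 (n + 1) = ∅ := Finset.Ico_eq_empty (by omega)
    have h3 : Finset.Ico 0 n = ∅ := Finset.Ico_eq_empty (by omega)
    rw [h1, h2, h3, Finset.sum_insert (by simp)]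
    simp

/-- The index of the tile of `x` that contains the point `r` of the line, when the tile of the
letter `x n` is `[cocycleSum s x n, cocycleSum s x (n + 1))`. -/
def tileIndex (s : Fin m → ℝ) (x : ℤ → Fin m) (r : ℝ) : ℤ :=
  sSup {n : ℤ | cocycleSum s x n ≤ r}

lemma tileIndex_spec {s : Fin m → ℝ} (hs : ∀ j, 0 < s j) (x : ℤ → Fin m) (r : ℝ) :
    cocycleSum s x (tileIndex s x r) ≤ r ∧ r < cocycleSum s x (tileIndex s x r + 1) := by
  have : Nonempty (Fin m) := ⟨x 0⟩
  obtain ⟨j₀, hj₀⟩ := Finite.exists_min s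
  have hδ := hs j₀
  set S := cocycleSum s x with hS
  have hup : ∀ n : ℕ, (n : ℝ) * s j₀ ≤ S n := by
    intro n
    induction n with
    | zero => simp [hS, cocycleSum_zero]
    | succ n ih =>
      have h := cocycleSum_succ s x n
      have h' := hj₀ (x n)
      push_cast
      rw [hS, h]
      linarith
  have hdn : ∀ n : ℕ, S (-(n : ℤ)) ≤ -((n : ℝ) * s j₀) := by
    intro n
    induction n with
    | zero => simp [hS, cocycleSum_zero]
    | succ n ih =>
      have h := cocycleSum_succ s x (-((n : ℤ) + 1))
      have h' := hj₀ (x (-((n : ℤ) + 1)))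
      rw [show -((n : ℤ) + 1) + 1 = -(n : ℤ) by ring] at h
      push_cast
      linarith
  have hmono : Monotone S := by
    refine monotone_int_of_le_succ fun n => ?_
    rw [hS, cocycleSum_succ]
    linarith [hs (x n)]
  have hne : {n : ℤ | S n ≤ r}.Nonempty := by
    obtain ⟨n, hn⟩ := exists_nat_gt (-r / s j₀)
    refine ⟨-(n : ℤ), (hdn n).trans ?_⟩
    rw [div_lt_iff₀ hδ] at hn
    linarith
  have hbdd : BddAbove {n : ℤ | S n ≤ r} := by
    obtain ⟨n, hn⟩ := exists_nat_gt (r / s j₀)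
    rw [div_lt_iff₀ hδ] at hn
    refine ⟨n, fun k hk => ?_⟩
    by_contra hlt
    have h1 := hmono (not_le.mp hlt).le
    have h2 : S k ≤ r := hk
    linarith [hup n]
  refine ⟨Int.csSup_mem hne hbdd, ?_⟩
  by_contra hlt
  have h1 : tileIndex s x r + 1 ≤ tileIndex s x r := le_csSup hbdd (not_lt.mp hlt)
  omega

/-- The phase space `{(x, t) : x ∈ X_a, 0 ≤ t < s_{x₀}}` of the suspension flow with the
piecewise constant roof function `x ↦ s_{x₀}`. -/
def suspension (a : ℕ → Substitution m) (s : Fin m → ℝ) : Set ((ℤ → Fin m) × ℝ) :=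
  {p | p.1 ∈ space a ∧ 0 ≤ p.2 ∧ p.2 < s (p.1 0)}

/-- The suspension flow `h_τ`: move up by `τ` and identify `(x, s_{x₀})` with `(T x, 0)`. It is
written for all of `(ℤ → Fin m) × ℝ` and sends `(x, t)` to the representative of `(x, t + τ)`. -/
def flow (s : Fin m → ℝ) (τ : ℝ) (p : (ℤ → Fin m) × ℝ) : (ℤ → Fin m) × ℝ :=
  (shift (tileIndex s p.1 (p.2 + τ)) p.1,
    p.2 + τ - cocycleSum s p.1 (tileIndex s p.1 (p.2 + τ)))

lemma shift_mem_space {a : ℕ → Substitution m} {x : ℤ → Fin m} (hx : x ∈ space a) (n : ℤ) :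
    shift n x ∈ space a := by
  intro i L
  obtain ⟨k, hk, b, hb⟩ := hx (i + n) L
  refine ⟨k, hk, b, ?_⟩
  have : (fun j : Fin L => shift n x (i + (j : ℤ))) = fun j : Fin L => x (i + n + (j : ℤ)) := by
    funext j
    simp only [shift]
    congr 1
    ring
  rwa [this]

/-- The flow preserves the phase space. -/
lemma flow_mem_suspension {a : ℕ → Substitution m} {s : Fin m → ℝ} (hs : ∀ j, 0 < s j) (τ : ℝ)
    {p : (ℤ → Fin m) × ℝ} (hp : p ∈ suspension a s) : flow s τ p ∈ suspension a s := by
  obtain ⟨h1, h2⟩ := tileIndex_spec hs p.1 (p.2 + τ)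
  refine ⟨shift_mem_space hp.1 _, ?_, ?_⟩
  · simp only [flow]; linarith
  · rw [cocycleSum_succ] at h2
    simp only [flow, shift, zero_add]
    linarith

/-- The invariant measure of the suspension flow: the restriction of `μ × Lebesgue` to the phase
space (of total mass `∑_j s_j μ[j]`). -/
def suspensionMeasure (a : ℕ → Substitution m) (s : Fin m → ℝ) (μ : Measure (ℤ → Fin m)) :
    Measure ((ℤ → Fin m) × ℝ) :=
  (μ.prod volume).restrict (suspension a s)

/-- The simple cylindrical function `f(x, t) = b_{x₀}`. -/
def simpleCyl (b : Fin m → ℂ) (p : (ℤ → Fin m) × ℝ) : ℂ := b (p.1 0)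

/-! ## Spectral measures and lower local dimension -/

/-- `σ` is the spectral measure of the function `f` for the flow `h` on `(Y, ν)`: the finite
Borel measure on `ℝ` with `∫ e^{2πiωt} dσ(ω) = ⟨f ∘ h_t, f⟩` for all `t`. -/
def IsSpectralMeasure {Y : Type*} [MeasurableSpace Y] (h : ℝ → Y → Y) (ν : Measure Y)
    (f : Y → ℂ) (σ : Measure ℝ) : Prop :=
  IsFiniteMeasure σ ∧ ∀ t : ℝ,
    ∫ ω : ℝ, Complex.exp (2 * Real.pi * Complex.I * ω * t) ∂σ =
      ∫ y, f (h t y) * (starRingEnd ℂ) (f y) ∂ν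

/-- The lower local dimension `liminf_{r → 0+} log σ(B_r(ω)) / log r`, in `[-∞, ∞]`. -/
def lowerDim (σ : Measure ℝ) (ω : ℝ) : EReal :=
  liminf (fun r : ℝ => ENNReal.log (σ (Metric.ball ω r)) / ((Real.log r : ℝ) : EReal)) (𝓝[>] 0)

end SAdic

end

open SAdic

/-!
# Local dimension of spectral measures of `S`-adic suspension flows

Write `z = Γ_ω b`, `ξ = ω s` and `g_x` for the cylindrical function `f` along the flow orbit of
`(x, 0)`. The twisted integral `∫ g_x(r) e^{-2πiωr} dr` over the patch of tiles spelling a word `v`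
has modulus `|Φ(v)|`, where `Φ = wordSum ξ z` is an exponential sum (`integral_patch`), and the
spectral cocycle computes `Φ(ζ^{[n]}(b)) = (𝓜_a(ξ, n) z)_b` (`cocycle_mulVec`). The mean square of
the twisted integrals of length `L` over the suspension is the mean of a Fejér-type kernel of width
`1 / L` against the spectral measure `σ_f` (`meanSq_eq_integral_fejer`). Let `χ > 0` be the exponent
of the cocycle along `z`; the claim is that the local dimension is `2 - 2χ/λ` (`lowerDim_eq`).

*The dimension is not smaller.* In the prefix--suffix decomposition of a factor `v` of a point of
the `S`-adic space, the words of level `n` that occur are no longer than `v`, and by `CondA1'` and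
`CondA2` all words of level `n` have length at least `e^{n(λ - ε)}`. Together with `CondA3`, which
bounds the number of words per level, this gives `|Φ(v)| = O(|v|^β)` for all `β > χ/λ`
(`exists_norm_wordSum_factor_le`), hence `σ_f(B_r(ω)) = O(r^{2 - 2β})` (`le_lowerDim`).

*The dimension is not larger.* For infinitely many `n` some `|Φ(ζ^{[n]}(c))|` is at least
`e^{n(χ - ε)}`, and by `CondA1'` the word `ζ^{[n]}(c)` occurs in every point with gaps at most
`e^{n(λ + ε)}` (`eventually_exists_window`). The integral over such a patch is an average of
integrals over intervals of the slightly smaller length `L ≈ e^{nλ(1 - δ)}`, up to boundary terms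
which are negligible by the upper bound. This bounds the mean square at scale `L` from below
(`le_meanSq`). If the dimension exceeded `2 - 2χ/λ`, a dyadic decomposition of the Fejér kernel
would contradict this bound (`exists_integral_fejer_le`, `lowerDim_le`).

*Exceptional vectors.* The `z` with exponent smaller than `χ^+` form a subspace which does not
contain some coordinate vector `e_j` (`exists_lyapVec_single_eq_lyap`), and `Γ_ω` is diagonal and
invertible for `ω ∉ ⋃ s_a⁻¹ ℤ`. So a line in direction `e_j` contains at most one exceptional
vector, and Fubini's theorem gives the almost sure statement (`ae_ae_not_exceptional`).
-/

open MeasureTheory Filter Topology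
open scoped ENNReal NNReal Matrix

noncomputable section

namespace SAdic

variable {m : ℕ}

/-! ### Exponential growth rates and Lyapunov exponents -/

lemma lyap_eq_expGrowthSup (a : ℕ → Substitution m) (ξ : Fin m → ℝ) :
    lyap a ξ = ExpGrowth.expGrowthSup fun n => (matNorm (cocycle a ξ n) : ℝ≥0∞) := rfl

lemma lyapVec_eq_expGrowthSup (a : ℕ → Substitution m) (ξ : Fin m → ℝ) (z : Fin m → ℂ) :
    lyapVec a ξ z = ExpGrowth.expGrowthSup fun n => (vecNorm (cocycle a ξ n *ᵥ z) : ℝ≥0∞) := rfl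

lemma ereal_exp_coe_mul (c : ℝ) (n : ℕ) :
    EReal.exp ((c : EReal) * n) = ENNReal.ofReal (Real.exp (c * n)) := by
  rw [← EReal.exp_coe]; norm_cast

lemma eventually_le_of_expGrowthSup_lt {u : ℕ → ℝ≥0} {c : ℝ}
    (h : ExpGrowth.expGrowthSup (fun n => (u n : ℝ≥0∞)) < c) :
    ∀ᶠ n : ℕ in atTop, (u n : ℝ) ≤ Real.exp (c * n) := by
  filter_upwards [ExpGrowth.eventually_le_exp h] with n hn
  rw [ereal_exp_coe_mul] at hn
  have := ENNReal.toReal_mono ENNReal.ofReal_ne_top hn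
  rwa [ENNReal.toReal_ofReal (Real.exp_nonneg _)] at this

lemma frequently_le_of_lt_expGrowthSup {u : ℕ → ℝ≥0} {c : ℝ}
    (h : (c : EReal) < ExpGrowth.expGrowthSup (fun n => (u n : ℝ≥0∞))) :
    ∃ᶠ n : ℕ in atTop, Real.exp (c * n) ≤ u n := by
  refine (ExpGrowth.frequently_exp_le h).mono fun n hn => ?_
  rw [ereal_exp_coe_mul] at hn
  have := ENNReal.toReal_mono ENNReal.coe_ne_top hn
  rwa [ENNReal.toReal_ofReal (Real.exp_nonneg _)] at this

lemma vecNorm_add_le (z w : Fin m → ℂ) : vecNorm (z + w) ≤ vecNorm z + vecNorm w := by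
  unfold vecNorm
  rw [← Finset.sum_add_distrib]
  exact Finset.sum_le_sum fun i _ => nnnorm_add_le _ _

lemma vecNorm_smul (c : ℂ) (z : Fin m → ℂ) : vecNorm (c • z) = ‖c‖₊ * vecNorm z := by
  simp [vecNorm, Finset.mul_sum]

lemma lyapVec_add_le (a : ℕ → Substitution m) (ξ : Fin m → ℝ) (z w : Fin m → ℂ) :
    lyapVec a ξ (z + w) ≤ max (lyapVec a ξ z) (lyapVec a ξ w) := by
  simp only [lyapVec_eq_expGrowthSup]
  rw [← ExpGrowth.expGrowthSup_add]
  refine ExpGrowth.expGrowthSup_monotone fun n => ?_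
  simp only [Pi.add_apply]
  rw [Matrix.mulVec_add]
  exact_mod_cast vecNorm_add_le _ _

lemma lyapVec_smul_le (a : ℕ → Substitution m) (ξ : Fin m → ℝ) (c : ℂ) (z : Fin m → ℂ) :
    lyapVec a ξ (c • z) ≤ lyapVec a ξ z := by
  simp only [lyapVec_eq_expGrowthSup]
  refine ExpGrowth.expGrowthSup_le_of_eventually_le (b := (‖c‖₊ : ℝ≥0∞)) ENNReal.coe_ne_top
    (Eventually.of_forall fun n => ?_)
  simp only [Matrix.mulVec_smul, vecNorm_smul]
  push_cast
  exact le_rfl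

lemma lyapVec_zero (a : ℕ → Substitution m) (ξ : Fin m → ℝ) : lyapVec a ξ 0 = ⊥ := by
  rw [lyapVec_eq_expGrowthSup, ← ExpGrowth.expGrowthSup_zero]
  congr 1
  ext n
  simp [vecNorm]

lemma matNorm_eq_sup_vecNorm (A : Matrix (Fin m) (Fin m) ℂ) :
    matNorm A = Finset.univ.sup fun j => vecNorm (A *ᵥ Pi.single j 1) := by
  unfold matNorm vecNorm
  simp

/-- The exponent of the matrix norm is attained in the direction of a coordinate vector, because
the `1`-norm of a matrix is the largest `1`-norm of a column. -/
lemma exists_lyapVec_single_eq_lyap [Nonempty (Fin m)] (a : ℕ → Substitution m)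
    (ξ : Fin m → ℝ) : ∃ j : Fin m, lyapVec a ξ (Pi.single j 1) = lyap a ξ := by
  have h : lyap a ξ = ⨆ j : Fin m, lyapVec a ξ (Pi.single j 1) := by
    simp only [lyap_eq_expGrowthSup, lyapVec_eq_expGrowthSup]
    rw [← ExpGrowth.expGrowthSup_iSup]
    congr 1
    ext n
    rw [iSup_apply, matNorm_eq_sup_vecNorm, Finset.apply_sup_eq_sup_comp_of_nonempty
      ENNReal.coe_mono Finset.univ_nonempty, Finset.sup_univ_eq_iSup]
    rfl
  obtain ⟨j, hj⟩ := exists_eq_ciSup_of_finite (f := fun j : Fin m => lyapVec a ξ (Pi.single j 1))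
  exact ⟨j, by rw [h, ← hj]⟩

lemma vecNorm_mulVec_le (A : Matrix (Fin m) (Fin m) ℂ) (z : Fin m → ℂ) :
    vecNorm (A *ᵥ z) ≤ vecNorm z * matNorm A := by
  unfold vecNorm
  calc ∑ i, ‖(A *ᵥ z) i‖₊ ≤ ∑ i, ∑ j, ‖A i j‖₊ * ‖z j‖₊ := by
        refine Finset.sum_le_sum fun i _ => ?_
        rw [Matrix.mulVec, dotProduct]
        refine (nnnorm_sum_le _ _).trans (Finset.sum_le_sum fun j _ => ?_)
        rw [nnnorm_mul]
    _ = ∑ j, ‖z j‖₊ * ∑ i, ‖A i j‖₊ := by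
        rw [Finset.sum_comm]
        refine Finset.sum_congr rfl fun j _ => ?_
        rw [Finset.mul_sum]
        exact Finset.sum_congr rfl fun i _ => mul_comm _ _
    _ ≤ (∑ j, ‖z j‖₊) * matNorm A := by
        rw [Finset.sum_mul]
        refine Finset.sum_le_sum fun j _ => ?_
        gcongr
        exact Finset.le_sup (f := fun j => ∑ i, ‖A i j‖₊) (Finset.mem_univ j)

lemma lyapVec_le_lyap (a : ℕ → Substitution m) (ξ : Fin m → ℝ) (z : Fin m → ℂ) :
    lyapVec a ξ z ≤ lyap a ξ := by
  simp only [lyapVec_eq_expGrowthSup, lyap_eq_expGrowthSup]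
  refine ExpGrowth.expGrowthSup_le_of_eventually_le (b := (vecNorm z : ℝ≥0∞)) ENNReal.coe_ne_top
    (Eventually.of_forall fun n => ?_)
  exact_mod_cast vecNorm_mulVec_le _ _

/-! ### Local dimension -/

lemma le_lowerDim_of_eventually_le {σ : Measure ℝ} {ω γ : ℝ}
    (h : ∀ᶠ r : ℝ in 𝓝[>] 0, σ (Metric.ball ω r) ≤ ENNReal.ofReal (r ^ γ)) :
    (γ : EReal) ≤ lowerDim σ ω := by
  refine le_liminf_of_le (by isBoundedDefault) ?_
  have h1 : ∀ᶠ r : ℝ in 𝓝[>] 0, r ∈ Set.Ioo (0 : ℝ) 1 := Ioo_mem_nhdsGT one_pos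
  filter_upwards [h, h1] with r hr ⟨hr0, hr1⟩
  have hlog : Real.log r < 0 := Real.log_neg hr0 hr1
  have h2 : ENNReal.log (σ (Metric.ball ω r)) ≤ ((γ * Real.log r : ℝ) : EReal) := by
    refine (ENNReal.log_monotone hr).trans (le_of_eq ?_)
    rw [ENNReal.log_ofReal_of_pos (Real.rpow_pos_of_pos hr0 _), Real.log_rpow hr0]
  refine le_trans (le_of_eq ?_)
    (EReal.div_le_div_right_of_nonpos (by exact_mod_cast hlog.le) h2)
  rw [← EReal.coe_div, mul_div_cancel_right₀ _ hlog.ne]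

lemma eventually_le_of_lt_lowerDim {σ : Measure ℝ} {ω γ : ℝ}
    (h : (γ : EReal) < lowerDim σ ω) :
    ∀ᶠ r : ℝ in 𝓝[>] 0, σ (Metric.ball ω r) ≤ ENNReal.ofReal (r ^ γ) := by
  have h1 : ∀ᶠ r : ℝ in 𝓝[>] 0, r ∈ Set.Ioo (0 : ℝ) 1 := Ioo_mem_nhdsGT one_pos
  filter_upwards [eventually_lt_of_lt_liminf h, h1] with r hr ⟨hr0, hr1⟩
  have hlog : Real.log r < 0 := Real.log_neg hr0 hr1
  by_contra hcon
  have h2 : ((γ * Real.log r : ℝ) : EReal) ≤ ENNReal.log (σ (Metric.ball ω r)) := by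
    refine le_trans (le_of_eq ?_) (ENNReal.log_monotone (not_le.mp hcon).le)
    rw [ENNReal.log_ofReal_of_pos (Real.rpow_pos_of_pos hr0 _), Real.log_rpow hr0]
  have h3 := EReal.div_le_div_right_of_nonpos (c := ((Real.log r : ℝ) : EReal))
    (by exact_mod_cast hlog.le) h2
  rw [← EReal.coe_div, mul_div_cancel_right₀ _ hlog.ne] at h3
  exact absurd hr (not_lt.mpr h3)

/-! ### Exponential sums along words -/

/-- The character `x ↦ exp (-2πi x)` of the real line. -/
def phase (x : ℝ) : ℂ := Complex.exp (-2 * Real.pi * Complex.I * (x : ℝ))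

lemma phase_zero : phase 0 = 1 := by simp [phase]

lemma phase_add (x y : ℝ) : phase (x + y) = phase x * phase y := by
  unfold phase
  rw [← Complex.exp_add]
  push_cast
  ring_nf

lemma norm_phase (x : ℝ) : ‖phase x‖ = 1 := by
  have : (-2 * Real.pi * Complex.I * (x : ℝ) : ℂ) = ((-2 * Real.pi * x : ℝ) : ℂ) * Complex.I := by
    push_cast; ring
  rw [phase, this, Complex.norm_exp_ofReal_mul_I]

lemma continuous_phase : Continuous phase := by
  unfold phase
  fun_prop

/-- The weighted exponential sum `∑_j exp (-2πi (ξ_{v₁} + … + ξ_{v_{j-1}})) z_{v_j}` over a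
word `v`. For `ξ = ω • s` and `z = Γ_ω b` this is the Fourier integral of the cylindrical function
with values `b` over a patch of tiles that spells `v` and starts at the origin. -/
def wordSum (ξ : Fin m → ℝ) (z : Fin m → ℂ) : List (Fin m) → ℂ
  | [] => 0
  | c :: v => z c + phase (ξ c) * wordSum ξ z v

lemma wordSum_append (ξ : Fin m → ℝ) (z : Fin m → ℂ) (u v : List (Fin m)) :
    wordSum ξ z (u ++ v) = wordSum ξ z u + phase ((u.map ξ).sum) * wordSum ξ z v := by
  induction u with
  | nil => simp [wordSum, phase_zero]
  | cons c u ih =>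
    simp only [List.cons_append, wordSum, ih, List.map_cons, List.sum_cons, phase_add]
    ring

lemma norm_wordSum_append_le (ξ : Fin m → ℝ) (z : Fin m → ℂ) (u v : List (Fin m)) :
    ‖wordSum ξ z (u ++ v)‖ ≤ ‖wordSum ξ z u‖ + ‖wordSum ξ z v‖ := by
  rw [wordSum_append]
  refine (norm_add_le _ _).trans ?_
  rw [norm_mul, norm_phase, one_mul]

lemma wordSum_eq_sum (ξ : Fin m → ℝ) (z : Fin m → ℂ) (v : List (Fin m)) :
    wordSum ξ z v = ∑ j : Fin v.length, phase (((v.take j).map ξ).sum) * z v[j] := by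
  induction v with
  | nil => simp [wordSum]
  | cons c v ih =>
    simp only [wordSum, ih, List.length_cons, Fin.sum_univ_succ, Finset.mul_sum]
    simp [phase_zero, phase_add, mul_assoc]

lemma wordSum_flatMap (ξ : Fin m → ℝ) (z : Fin m → ℂ) (W : Fin m → List (Fin m))
    (v : List (Fin m)) :
    wordSum ξ z (v.flatMap W) =
      wordSum (fun c => ((W c).map ξ).sum) (fun c => wordSum ξ z (W c)) v := by
  induction v with
  | nil => simp [wordSum]
  | cons c v ih => simp [wordSum, wordSum_append, ih]

lemma norm_wordSum_flatMap_le (ξ : Fin m → ℝ) (z : Fin m → ℂ) (W : Fin m → List (Fin m))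
    {D : ℝ} (hD : ∀ c, ‖wordSum ξ z (W c)‖ ≤ D) (v : List (Fin m)) :
    ‖wordSum ξ z (v.flatMap W)‖ ≤ v.length * D := by
  induction v with
  | nil => simp [wordSum]
  | cons c v ih =>
    rw [List.flatMap_cons]
    refine (norm_wordSum_append_le _ _ _ _).trans ?_
    push_cast [List.length_cons]
    linarith [hD c]

lemma spectralMat_mulVec (ζ : Substitution m) (ξ : Fin m → ℝ) (z : Fin m → ℂ) (b : Fin m) :
    (ζ.spectralMat ξ *ᵥ z) b = wordSum ξ z (ζ.word b) := by
  rw [wordSum_eq_sum]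
  simp only [Matrix.mulVec, dotProduct, Substitution.spectralMat, Matrix.of_apply,
    Finset.sum_mul]
  rw [Finset.sum_comm]
  refine Finset.sum_congr rfl fun j _ => ?_
  simp [ite_mul, phase]

lemma sum_count_mul {R : Type*} [CommSemiring R] (v : List (Fin m)) (ξ : Fin m → R) :
    ∑ i, (v.count i : R) * ξ i = (v.map ξ).sum := by
  induction v with
  | nil => simp
  | cons c v ih =>
    simp only [List.count_cons, List.map_cons, List.sum_cons, ← ih, Nat.cast_add, add_mul,
      Finset.sum_add_distrib]
    rw [add_comm]
    congr 1
    simp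

lemma realMat_transpose_mulVec (ζ : Substitution m) (ξ : Fin m → ℝ) :
    (realMat ζ)ᵀ *ᵥ ξ = fun c => ((ζ.word c).map ξ).sum := by
  ext c
  rw [← sum_count_mul]
  simp [Matrix.mulVec, dotProduct, realMat, Substitution.mat]

/-- The spectral cocycle applied to `z` records the exponential sums over the words `ζ^{[n]}(b)`. -/
lemma cocycle_mulVec (a : ℕ → Substitution m) (ξ : Fin m → ℝ) (z : Fin m → ℂ) (n : ℕ) :
    cocycle a ξ n *ᵥ z = fun b => wordSum ξ z ((prodSub a n).word b) := by
  induction n with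
  | zero => ext b; simp [cocycle, prodSub, Substitution.one, wordSum]
  | succ n ih =>
    ext b
    rw [cocycle, ← Matrix.mulVec_mulVec, ih, spectralMat_mulVec, realMat_transpose_mulVec,
      ← wordSum_flatMap]
    rfl

/-! ### Factors of concatenations -/

lemma prefix_flatMap_decomp {α β : Type*} [Nonempty α] (W : α → List β) :
    ∀ (u : List α) (v : List β), v <+: u.flatMap W →
      ∃ (mid : List α) (p : List β) (c : α), v = mid.flatMap W ++ p ∧ mid.length ≤ u.length ∧
        p <+: W c
  | [], v, h => by
    refine ⟨[], [], Classical.arbitrary α, ?_, le_rfl, List.nil_prefix⟩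
    simpa using h
  | c :: u, v, h => by
    rw [List.flatMap_cons] at h
    obtain ⟨r, hr⟩ := h
    rcases List.append_eq_append_iff.mp hr with ⟨w, h1, -⟩ | ⟨w, rfl, h2⟩
    · exact ⟨[], v, c, by simp, by simp, w, h1.symm⟩
    · obtain ⟨mid, p, d, rfl, h2, h3⟩ := prefix_flatMap_decomp W u w ⟨r, h2.symm⟩
      exact ⟨c :: mid, p, d, by simp, by simpa using h2, h3⟩

lemma suffix_flatMap_decomp {α β : Type*} [Nonempty α] (W : α → List β) :
    ∀ (u : List α) (v : List β), v <:+ u.flatMap W →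
      ∃ (mid : List α) (p : List β) (c : α), v = p ++ mid.flatMap W ∧ mid.length ≤ u.length ∧
        p <:+ W c
  | [], v, h => by
    refine ⟨[], [], Classical.arbitrary α, ?_, le_rfl, List.nil_suffix⟩
    simpa using h
  | c :: u, v, h => by
    rw [List.flatMap_cons] at h
    obtain ⟨r, hr⟩ := h
    rcases List.append_eq_append_iff.mp hr with ⟨w, h1, rfl⟩ | ⟨w, -, h2⟩
    · exact ⟨u, w, c, rfl, by simp, r, h1.symm⟩
    · obtain ⟨mid, p, d, rfl, h3, h4⟩ := suffix_flatMap_decomp W u v ⟨w, h2.symm⟩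
      exact ⟨mid, p, d, rfl, by simp; omega, h4⟩

lemma infix_flatMap_decomp {α β : Type*} [Nonempty α] (W : α → List β) :
    ∀ (u : List α) (v : List β), v <:+: u.flatMap W →
      (∃ c, v <:+: W c) ∨
      ∃ (q : List β) (mid : List α) (p : List β) (c d : α), v = q ++ mid.flatMap W ++ p ∧
        mid.length ≤ u.length ∧ q <:+ W c ∧ p <+: W d
  | [], v, h => by
    refine Or.inl ⟨Classical.arbitrary α, ?_⟩
    have : v = [] := by simpa using h
    rw [this]
    exact List.nil_infix
  | c :: u, v, h => by
    rw [List.flatMap_cons, List.infix_append_iff] at h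
    rcases h with h | h | ⟨q, w, rfl, hq, hw⟩
    · exact Or.inl ⟨c, h⟩
    · rcases infix_flatMap_decomp W u v h with h | ⟨q, mid, p, c, d, h1, h2, h3⟩
      · exact Or.inl h
      · exact Or.inr ⟨q, mid, p, c, d, h1, by simp; omega, h3⟩
    · obtain ⟨mid, p, d, rfl, h2, h3⟩ := prefix_flatMap_decomp W u w hw
      exact Or.inr ⟨q, mid, p, c, d, by simp, by simp; omega, hq, h3⟩

/-! ### Exponential sums over factors of the words `ζ^{[n]}(b)` -/

section FactorBound

variable {a : ℕ → Substitution m} {ξ : Fin m → ℝ} {z : Fin m → ℂ} {D K t : ℕ → ℝ} {β Z : ℝ}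

lemma norm_wordSum_blocks_le (hβ : 0 ≤ β)
    (hD : ∀ k c, ‖wordSum ξ z ((prodSub a k).word c)‖ ≤ D k)
    (hDt : ∀ k b, K k * D k ≤ t k * ((prodSub a k).word b).length ^ β) {k : ℕ} (ht : 0 ≤ t k)
    {mid v : List (Fin m)} (hmid : (mid.length : ℝ) ≤ K k)
    (hv : (mid.flatMap (prodSub a k).word).length ≤ v.length) :
    ‖wordSum ξ z (mid.flatMap (prodSub a k).word)‖ ≤ t k * v.length ^ β := by
  rcases mid with _ | ⟨c, mid⟩
  · simp only [List.flatMap_nil, wordSum, norm_zero]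
    positivity
  · have hD0 : 0 ≤ D k := (norm_nonneg _).trans (hD k c)
    calc _ ≤ ((c :: mid).length : ℝ) * D k := norm_wordSum_flatMap_le _ _ _ (hD k) _
      _ ≤ K k * D k := by gcongr
      _ ≤ t k * ((prodSub a k).word c).length ^ β := hDt k c
      _ ≤ t k * v.length ^ β := by
        gcongr
        refine le_trans ?_ hv
        simp

lemma norm_wordSum_base_le (hZ : ∀ c, ‖z c‖ ≤ Z) {v : List (Fin m)} {c : Fin m}
    (hv : v <:+: [c]) : ‖wordSum ξ z v‖ ≤ Z * v.length ^ β := by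
  have hl : v.length ≤ 1 := by simpa using hv.length_le
  have hZ0 : 0 ≤ Z := (norm_nonneg _).trans (hZ c)
  rcases v with _ | ⟨d, _ | ⟨_, v⟩⟩
  · simp only [wordSum, norm_zero]; positivity
  · simpa [wordSum] using hZ d
  · simp at hl

lemma norm_wordSum_prefix_le [Nonempty (Fin m)] (hβ : 0 ≤ β) (hZ : ∀ c, ‖z c‖ ≤ Z)
    (hD : ∀ k c, ‖wordSum ξ z ((prodSub a k).word c)‖ ≤ D k)
    (hK : ∀ k c, (((a k).word c).length : ℝ) ≤ K k) (ht : ∀ k, 0 ≤ t k)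
    (hDt : ∀ k b, K k * D k ≤ t k * ((prodSub a k).word b).length ^ β) (N : ℕ) :
    ∀ (b : Fin m) (v : List (Fin m)), v <+: (prodSub a N).word b →
      ‖wordSum ξ z v‖ ≤ (Z + ∑ k ∈ Finset.range N, t k) * v.length ^ β := by
  have hZ0 : 0 ≤ Z := (norm_nonneg _).trans (hZ (Classical.arbitrary _))
  induction N with
  | zero =>
    intro b v hv
    simpa using norm_wordSum_base_le hZ hv.isInfix
  | succ N ih =>
    intro b v hv
    have hs : 0 ≤ ∑ k ∈ Finset.range N, t k := Finset.sum_nonneg fun k _ => ht k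
    obtain ⟨mid, p, d, rfl, h2, h3⟩ := prefix_flatMap_decomp _ _ _ hv
    refine (norm_wordSum_append_le _ _ _ _).trans ?_
    rw [Finset.sum_range_succ, ← add_assoc, add_mul, add_comm]
    refine add_le_add ((ih d p h3).trans ?_) (norm_wordSum_blocks_le hβ hD hDt (ht N)
      (le_trans (by exact_mod_cast h2) (hK N b)) (by simp))
    gcongr
    simp

lemma norm_wordSum_suffix_le [Nonempty (Fin m)] (hβ : 0 ≤ β) (hZ : ∀ c, ‖z c‖ ≤ Z)
    (hD : ∀ k c, ‖wordSum ξ z ((prodSub a k).word c)‖ ≤ D k)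
    (hK : ∀ k c, (((a k).word c).length : ℝ) ≤ K k) (ht : ∀ k, 0 ≤ t k)
    (hDt : ∀ k b, K k * D k ≤ t k * ((prodSub a k).word b).length ^ β) (N : ℕ) :
    ∀ (b : Fin m) (v : List (Fin m)), v <:+ (prodSub a N).word b →
      ‖wordSum ξ z v‖ ≤ (Z + ∑ k ∈ Finset.range N, t k) * v.length ^ β := by
  have hZ0 : 0 ≤ Z := (norm_nonneg _).trans (hZ (Classical.arbitrary _))
  induction N with
  | zero =>
    intro b v hv
    simpa using norm_wordSum_base_le hZ hv.isInfix
  | succ N ih =>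
    intro b v hv
    have hs : 0 ≤ ∑ k ∈ Finset.range N, t k := Finset.sum_nonneg fun k _ => ht k
    obtain ⟨mid, p, d, rfl, h2, h3⟩ := suffix_flatMap_decomp _ _ _ hv
    refine (norm_wordSum_append_le _ _ _ _).trans ?_
    rw [Finset.sum_range_succ, ← add_assoc, add_mul]
    refine add_le_add ((ih d p h3).trans ?_) (norm_wordSum_blocks_le hβ hD hDt (ht N)
      (le_trans (by exact_mod_cast h2) (hK N b)) (by simp))
    gcongr
    simp

/-- A factor of `ζ^{[N]}(b)` either lies in a shorter word `ζ^{[N-1]}(c)`, or is a suffix of such a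
word, followed by full words, followed by a prefix. In the prefix--suffix decomposition obtained by
iteration, level `k` contributes only if the factor contains a full word `ζ^{[k]}(c)`, so that every
contribution is controlled by the length of the factor. -/
lemma norm_wordSum_infix_le [Nonempty (Fin m)] (hβ : 0 ≤ β) (hZ : ∀ c, ‖z c‖ ≤ Z)
    (hD : ∀ k c, ‖wordSum ξ z ((prodSub a k).word c)‖ ≤ D k)
    (hK : ∀ k c, (((a k).word c).length : ℝ) ≤ K k) (ht : ∀ k, 0 ≤ t k)
    (hDt : ∀ k b, K k * D k ≤ t k * ((prodSub a k).word b).length ^ β) (N : ℕ) :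
    ∀ (b : Fin m) (v : List (Fin m)), v <:+: (prodSub a N).word b →
      ‖wordSum ξ z v‖ ≤ 2 * (Z + ∑ k ∈ Finset.range N, t k) * v.length ^ β := by
  have hZ0 : 0 ≤ Z := (norm_nonneg _).trans (hZ (Classical.arbitrary _))
  induction N with
  | zero =>
    intro b v hv
    refine (norm_wordSum_base_le (β := β) hZ hv).trans ?_
    simp only [Finset.range_zero, Finset.sum_empty, add_zero]
    gcongr
    linarith
  | succ N ih =>
    intro b v hv
    have hs : 0 ≤ ∑ k ∈ Finset.range N, t k := Finset.sum_nonneg fun k _ => ht k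
    have htN := ht N
    rcases infix_flatMap_decomp _ _ _ hv with ⟨c, hc⟩ | ⟨q, mid, p, c, d, hveq, h2, h3, h4⟩
    · refine (ih c v hc).trans ?_
      rw [Finset.sum_range_succ]
      gcongr
      linarith
    · have hq : ‖wordSum ξ z q‖ ≤ (Z + ∑ k ∈ Finset.range N, t k) * v.length ^ β := by
        refine (norm_wordSum_suffix_le hβ hZ hD hK ht hDt N c q h3).trans ?_
        gcongr
        simp [hveq]
      have hp : ‖wordSum ξ z p‖ ≤ (Z + ∑ k ∈ Finset.range N, t k) * v.length ^ β := by
        refine (norm_wordSum_prefix_le hβ hZ hD hK ht hDt N d p h4).trans ?_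
        gcongr
        simp only [hveq, List.length_append]
        omega
      have hm : ‖wordSum ξ z (mid.flatMap (prodSub a N).word)‖ ≤ t N * v.length ^ β :=
        norm_wordSum_blocks_le hβ hD hDt (ht N)
          (le_trans (by exact_mod_cast h2) (hK N b)) (by
            simp only [hveq, List.length_append]; omega)
      have h1 := norm_wordSum_append_le ξ z (q ++ mid.flatMap (prodSub a N).word) p
      have h2 := norm_wordSum_append_le ξ z q (mid.flatMap (prodSub a N).word)
      have h0 : 0 ≤ t N * (v.length : ℝ) ^ β := by positivity
      rw [← hveq] at h1
      rw [Finset.sum_range_succ]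
      calc ‖wordSum ξ z v‖ ≤ _ := h1
        _ ≤ _ := add_le_add h2 le_rfl
        _ ≤ (Z + ∑ k ∈ Finset.range N, t k) * v.length ^ β + t N * v.length ^ β
            + (Z + ∑ k ∈ Finset.range N, t k) * v.length ^ β := by gcongr
        _ ≤ _ := by nlinarith

end FactorBound

/-! ### Lengths of the words `ζ^{[n]}(b)` -/

lemma matNorm_realMat (ζ : Substitution m) :
    matNorm (realMat ζ) = ((Finset.univ.sup fun b => (ζ.word b).length : ℕ) : ℝ≥0) := by
  have h (b : Fin m) : ∑ i, ‖realMat ζ i b‖₊ = ((ζ.word b).length : ℝ≥0) := by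
    have := sum_count_mul (R := ℝ≥0) (ζ.word b) (fun _ => 1)
    simp only [mul_one, List.map_const', List.sum_replicate, nsmul_eq_mul] at this
    rw [← this]
    simp [realMat, Substitution.mat]
  unfold matNorm
  simp only [h]
  exact (Finset.apply_sup_eq_sup_comp (fun n : ℕ => (n : ℝ≥0)) (fun x y => Nat.cast_max ..)
    (by simp)).symm

/-- The maximal length of the words `ζ^{[n]}(b)`. -/
def maxLength (a : ℕ → Substitution m) (n : ℕ) : ℕ :=
  Finset.univ.sup fun b => ((prodSub a n).word b).length

lemma length_le_maxLength (a : ℕ → Substitution m) (n : ℕ) (b : Fin m) :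
    ((prodSub a n).word b).length ≤ maxLength a n :=
  Finset.le_sup (f := fun b => ((prodSub a n).word b).length) (Finset.mem_univ b)

lemma one_le_length (ζ : Substitution m) (b : Fin m) : 1 ≤ (ζ.word b).length :=
  List.length_pos_iff.mpr (ζ.word_ne_nil b)

lemma one_le_maxLength [Nonempty (Fin m)] (a : ℕ → Substitution m) (n : ℕ) :
    1 ≤ maxLength a n :=
  (one_le_length _ (Classical.arbitrary _)).trans (length_le_maxLength a n _)

lemma exists_length_eq_maxLength [Nonempty (Fin m)] (a : ℕ → Substitution m) (n : ℕ) :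
    ∃ b, ((prodSub a n).word b).length = maxLength a n := by
  obtain ⟨b, -, hb⟩ := Finset.exists_mem_eq_sup Finset.univ Finset.univ_nonempty
    (fun b => ((prodSub a n).word b).length)
  exact ⟨b, hb.symm⟩

lemma word_prodSub_add (a : ℕ → Substitution m) (i k : ℕ) (b : Fin m) :
    (prodSub a (i + k)).word b =
      ((prodSub (fun j => a (i + j)) k).word b).flatMap (prodSub a i).word := by
  induction k generalizing b with
  | zero => simp [prodSub, Substitution.one]
  | succ k ih =>
    rw [← add_assoc]
    simp only [prodSub, Substitution.comp, List.flatMap_assoc]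
    exact List.flatMap_congr fun c _ => ih c

lemma mat_comp (ζ η : Substitution m) : (ζ.comp η).mat = ζ.mat * η.mat := by
  ext i j
  simp only [Substitution.mat, Substitution.comp, Matrix.of_apply, Matrix.mul_apply,
    List.count_flatMap]
  have := sum_count_mul (R := ℕ) (η.word j) (fun c => (ζ.word c).count i)
  rw [show (List.count i ∘ ζ.word) = fun c => (ζ.word c).count i from rfl, ← this]
  exact Finset.sum_congr rfl fun c _ => mul_comm _ _

lemma mat_prodSub (a : ℕ → Substitution m) (n : ℕ) :
    (prodSub a n).mat = ((List.range n).map fun k => (a k).mat).prod := by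
  induction n with
  | zero =>
    ext i j
    rcases eq_or_ne j i with rfl | h
    · simp [prodSub, Substitution.one, Substitution.mat]
    · simp [prodSub, Substitution.one, Substitution.mat, h, h.symm]
  | succ n ih => rw [prodSub, mat_comp, ih, List.prod_range_succ]

/-- If a block with positive matrix occurs in `ζ_{i+1}, …, ζ_n`, then all letters occur in all words
`ζ_{i+1} ∘ ⋯ ∘ ζ_n (b)`. -/
lemma mem_word_of_block {a : ℕ → Substitution m} {q : List (Substitution m)}
    (hq : ∀ i j, 0 < (q.map Substitution.mat).prod i j) {l : ℕ} (hl : q.length ≤ l)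
    (h : ∀ k : Fin q.length, a k = q[k]) (b c : Fin m) : c ∈ (prodSub a l).word b := by
  obtain ⟨r, rfl⟩ := Nat.exists_eq_add_of_le hl
  rw [word_prodSub_add]
  obtain ⟨d, hd⟩ := List.exists_mem_of_ne_nil _
    ((prodSub (fun j => a (q.length + j)) r).word_ne_nil b)
  refine List.mem_flatMap.mpr ⟨d, hd, ?_⟩
  have h1 : q.map Substitution.mat = (List.range q.length).map fun k => (a k).mat := by
    refine List.ext_getElem (by simp) fun k h2 h3 => ?_
    have hk : k < q.length := by simpa using h2
    have := h ⟨k, hk⟩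
    simp only [List.getElem_map, List.getElem_range]
    rw [show a k = q[k] from this]
  have h2 := hq c d
  rw [h1, ← mat_prodSub] at h2
  exact List.count_pos_iff.mp h2

/-- Since every letter occurs in some `ζ_{n+1}(b)`, the words of level `n` are factors of words of
any higher level. -/
lemma exists_infix_of_le {a : ℕ → Substitution m} (ha : ∀ n, (a n).InClass) {n N : ℕ}
    (h : n ≤ N) (c : Fin m) : ∃ b, (prodSub a n).word c <:+: (prodSub a N).word b := by
  induction N, h using Nat.le_induction with
  | base => exact ⟨c, List.infix_rfl⟩
  | succ N _ ih =>
    obtain ⟨d, hd⟩ := ih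
    obtain ⟨b, hb⟩ := (ha N).1 d
    exact ⟨b, hd.trans (List.infix_flatMap_of_mem hb _)⟩

/-- Under `CondA1'`, for large `n` the words of level `n` contain all words of levels up to
`⌊n (1 - ε)⌋`. -/
lemma CondA1'.eventually_infix {a : ℕ → Substitution m} (ha : ∀ n, (a n).InClass)
    (hA1 : CondA1' a) {ε : ℝ} (hε : 0 < ε) :
    ∀ᶠ n : ℕ in atTop, ∀ k ≤ ⌊(n : ℝ) * (1 - ε)⌋₊, ∀ b c,
      (prodSub a k).word c <:+: (prodSub a n).word b := by
  obtain ⟨q, hq, h⟩ := hA1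
  obtain ⟨n₀, hn₀⟩ := h ε hε
  filter_upwards [eventually_ge_atTop n₀] with n hn k hk b c
  obtain ⟨i, h1, h2, h3⟩ := hn₀ n hn
  obtain ⟨d, hd⟩ := exists_infix_of_le ha (hk.trans h1) c
  obtain ⟨l, rfl⟩ := Nat.exists_eq_add_of_le (show i ≤ n by omega)
  rw [word_prodSub_add]
  exact hd.trans (List.infix_flatMap_of_mem (mem_word_of_block hq (by omega) h3 b d) _)

lemma CondA2.eventually_maxLength [Nonempty (Fin m)] {a : ℕ → Substitution m} {lam : ℝ}
    (hA2 : CondA2 a lam) {ε : ℝ} (hε : 0 < ε) :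
    ∀ᶠ n : ℕ in atTop, Real.exp ((lam - ε) * n) ≤ maxLength a n ∧
      (maxLength a n : ℝ) ≤ Real.exp ((lam + ε) * n) := by
  unfold CondA2 at hA2
  filter_upwards [hA2.eventually (Ioo_mem_nhds (show lam - ε < lam by linarith)
    (show lam < lam + ε by linarith)), eventually_gt_atTop 0] with n hn hn0
  have hn0' : (0 : ℝ) < n := by exact_mod_cast hn0
  have hpos : (0 : ℝ) < maxLength a n := by exact_mod_cast one_le_maxLength a n
  rw [matNorm_realMat] at hn
  change _ < Real.log (((maxLength a n : ℕ) : ℝ≥0) : ℝ) / n ∧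
    Real.log (((maxLength a n : ℕ) : ℝ≥0) : ℝ) / n < _ at hn
  rw [NNReal.coe_natCast, lt_div_iff₀ hn0', div_lt_iff₀ hn0'] at hn
  exact ⟨((Real.lt_log_iff_exp_lt hpos).mp hn.1).le, ((Real.log_lt_iff_lt_exp hpos).mp hn.2).le⟩

/-- All words `ζ^{[n]}(b)`, not only the longest one, have length at least `exp ((λ - ε) n)`. -/
lemma eventually_le_length [Nonempty (Fin m)] {a : ℕ → Substitution m}
    (ha : ∀ n, (a n).InClass) (hA1 : CondA1' a) {lam : ℝ} (hlam : 0 < lam)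
    (hA2 : CondA2 a lam) {ε : ℝ} (hε : 0 < ε) :
    ∀ᶠ n : ℕ in atTop, ∀ b, Real.exp ((lam - ε) * n) ≤ ((prodSub a n).word b).length := by
  rcases le_or_gt lam ε with hle | hlt
  · refine Eventually.of_forall fun n b => ?_
    have h1 : (1 : ℝ) ≤ ((prodSub a n).word b).length := by exact_mod_cast one_le_length _ b
    refine le_trans (Real.exp_le_one_iff.mpr ?_) h1
    exact mul_nonpos_of_nonpos_of_nonneg (by linarith) (by positivity)
  have hδ : 0 < ε / (3 * lam) := by positivity
  have hδ1 : ε / (3 * lam) < 1 := by rw [div_lt_one (by positivity)]; linarith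
  have hfl : Tendsto (fun n : ℕ => ⌊(n : ℝ) * (1 - ε / (3 * lam))⌋₊) atTop atTop :=
    tendsto_nat_floor_atTop.comp
      (tendsto_natCast_atTop_atTop.atTop_mul_const (by linarith))
  filter_upwards [hA1.eventually_infix ha hδ, hfl.eventually
    (hA2.eventually_maxLength (show 0 < ε / 3 by positivity)),
    eventually_ge_atTop ⌈3 * lam / ε⌉₊] with n h1 h2 h3 b
  set k := ⌊(n : ℝ) * (1 - ε / (3 * lam))⌋₊ with hk
  obtain ⟨c, hc⟩ := exists_length_eq_maxLength a k
  have h4 : (maxLength a k : ℝ) ≤ ((prodSub a n).word b).length := by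
    rw [← hc]; exact_mod_cast (h1 k le_rfl b c).length_le
  refine le_trans (Real.exp_le_exp.mpr ?_) (h2.1.trans h4)
  have h5 : (n : ℝ) * (1 - ε / (3 * lam)) - 1 ≤ k := (Nat.sub_one_lt_floor _).le
  have h6 : 3 * lam / ε ≤ n := (Nat.le_ceil _).trans (by exact_mod_cast h3)
  rw [div_le_iff₀ hε] at h6
  have h7 : (lam - ε / 3) * ((n : ℝ) * (1 - ε / (3 * lam)) - 1) ≤ (lam - ε / 3) * k :=
    mul_le_mul_of_nonneg_left h5 (by linarith)
  refine le_trans ?_ h7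
  have h8 : ε / (3 * lam) * lam = ε / 3 := by field_simp
  have h9 : 0 ≤ ε / 3 * (ε / (3 * lam)) * n := by positivity
  nlinarith

lemma CondA3.eventually_length_le {a : ℕ → Substitution m} (hA3 : CondA3 a) {ε : ℝ}
    (hε : 0 < ε) :
    ∀ᶠ n : ℕ in atTop, (((Finset.univ.sup fun b => ((a n).word b).length : ℕ)) : ℝ) ≤
      Real.exp (ε * n) := by
  unfold CondA3 at hA3
  filter_upwards [hA3.eventually (gt_mem_nhds (show 0 < ε / 2 by positivity)),
    eventually_ge_atTop 1] with n hn hn1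
  have hn1' : (1 : ℝ) ≤ n := by exact_mod_cast hn1
  rw [matNorm_realMat, NNReal.coe_natCast, div_lt_iff₀ (by positivity),
    Real.log_lt_iff_lt_exp (by positivity)] at hn
  have : Real.exp (ε / 2 * (n + 1)) ≤ Real.exp (ε * n) := Real.exp_le_exp.mpr (by nlinarith)
  linarith

/-- The factor of a two-sided sequence of length `L` that starts at coordinate `i`. -/
def factor (x : ℤ → Fin m) (i : ℤ) (L : ℕ) : List (Fin m) :=
  List.ofFn fun k : Fin L => x (i + (k : ℤ))

lemma exists_factor_infix {a : ℕ → Substitution m} (ha : ∀ n, (a n).InClass) {x : ℤ → Fin m}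
    (hx : x ∈ space a) (i : ℤ) (L n : ℕ) :
    ∃ N b, n ≤ N ∧ factor x i L <:+: (prodSub a N).word b := by
  obtain ⟨k, -, b, hb⟩ := hx i L
  obtain ⟨c, hc⟩ := exists_infix_of_le ha (le_max_left k n) b
  exact ⟨max k n, c, le_max_right _ _, hb.trans hc⟩

lemma exists_factor_eq_of_infix {x : ℤ → Fin m} {i : ℤ} {L : ℕ} {v : List (Fin m)}
    (h : v <:+: factor x i L) :
    ∃ p : ℕ, p + v.length ≤ L ∧ factor x (i + p) v.length = v := by
  obtain ⟨s, t, hst⟩ := h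
  have hlen : s.length + v.length + t.length = L := by
    have := congrArg List.length hst
    simpa [factor, add_assoc] using this
  refine ⟨s.length, by omega, ?_⟩
  refine List.ext_getElem (by simp [factor]) fun k h1 h2 => ?_
  have h3 : (factor x i L)[s.length + k]? = some v[k] := by
    rw [← hst, List.append_assoc, List.getElem?_append_right (by omega),
      List.getElem?_append_left (by omega)]
    simp [h2]
  have h4 : (factor x i L)[s.length + k]? = some (x (i + ((s.length + k : ℕ) : ℤ))) := by
    rw [factor, List.getElem?_ofFn, dif_pos (by omega)]
  rw [h4] at h3
  simp only [factor, List.getElem_ofFn]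
  rw [← Option.some.inj h3]
  push_cast
  rw [add_assoc]

/-- Words `ζ^{[n]}(b)` occur in every point of the `S`-adic space with gaps at most
`exp ((λ + ε) n)`. -/
lemma eventually_exists_window [Nonempty (Fin m)] {a : ℕ → Substitution m}
    (ha : ∀ n, (a n).InClass) (hA1 : CondA1' a) {lam : ℝ} (hlam : 0 < lam)
    (hA2 : CondA2 a lam) {ε : ℝ} (hε : 0 < ε) :
    ∀ᶠ n : ℕ in atTop, ∃ W : ℕ, 0 < W ∧ (W : ℝ) ≤ Real.exp ((lam + ε) * n) ∧
      ∀ x ∈ space a, ∀ b, ∃ p : ℕ, p + ((prodSub a n).word b).length ≤ W ∧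
        factor x p ((prodSub a n).word b).length = (prodSub a n).word b := by
  -- The window of level `n` is built from words of level `N = ⌈κ n⌉` with `κ` close to `1`.
  obtain ⟨δ, hδ0, hδ⟩ : ∃ δ : ℝ, 0 < δ ∧ (lam + δ) * (1 + δ) ≤ lam + ε / 2 := by
    have hc : ContinuousAt (fun δ : ℝ => (lam + δ) * (1 + δ)) 0 := by fun_prop
    have h1 : ∀ᶠ δ : ℝ in 𝓝 0, (lam + δ) * (1 + δ) < lam + ε / 2 :=
      hc.eventually (gt_mem_nhds (by simp; positivity))
    obtain ⟨δ, h2, h3⟩ := ((h1.filter_mono nhdsWithin_le_nhds).and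
      (self_mem_nhdsWithin (s := Set.Ioi (0 : ℝ)))).exists
    exact ⟨δ, h3, h2.le⟩
  have hκ : 0 < 1 - 1 / (1 + δ) := by
    rw [sub_pos, div_lt_one (by positivity)]; linarith
  have hce : Tendsto (fun n : ℕ => ⌈(n : ℝ) * (1 + δ)⌉₊) atTop atTop :=
    tendsto_nat_ceil_atTop.comp (tendsto_natCast_atTop_atTop.atTop_mul_const (by linarith))
  have hlarge : ∀ᶠ n : ℕ in atTop, lam + δ + Real.log 3 ≤ ε / 2 * n :=
    (tendsto_natCast_atTop_atTop.const_mul_atTop (by positivity)).eventually_ge_atTop _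
  filter_upwards [hce.eventually (hA1.eventually_infix ha hκ),
    hce.eventually (hA2.eventually_maxLength hδ0), hlarge] with n h1 h2 h3
  set N := ⌈(n : ℝ) * (1 + δ)⌉₊ with hN
  have hN1 : (n : ℝ) * (1 + δ) ≤ N := Nat.le_ceil _
  have hN2 : (N : ℝ) ≤ n * (1 + δ) + 1 := (Nat.ceil_lt_add_one (by positivity)).le
  have hn : n ≤ ⌊(N : ℝ) * (1 - (1 - 1 / (1 + δ)))⌋₊ := by
    refine Nat.le_floor ?_
    rw [sub_sub_cancel, mul_one_div, le_div_iff₀ (by positivity)]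
    exact hN1
  have hM : (1 : ℝ) ≤ maxLength a N := by exact_mod_cast one_le_maxLength a N
  refine ⟨2 * maxLength a N + 1, by omega, ?_, ?_⟩
  · push_cast
    calc 2 * (maxLength a N : ℝ) + 1 ≤ 3 * maxLength a N := by linarith
      _ ≤ 3 * Real.exp ((lam + δ) * N) := by gcongr; exact h2.2
      _ = Real.exp (Real.log 3 + (lam + δ) * N) := by
        rw [Real.exp_add, Real.exp_log (by norm_num)]
      _ ≤ Real.exp ((lam + ε) * n) := by
        refine Real.exp_le_exp.mpr ?_
        have h4 : (lam + δ) * N ≤ (lam + δ) * (n * (1 + δ) + 1) := by gcongr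
        have h5 := mul_le_mul_of_nonneg_right hδ (Nat.cast_nonneg (α := ℝ) n)
        nlinarith
  · intro x hx b
    obtain ⟨N', c, hNN', hc⟩ := exists_factor_infix ha hx 0 (2 * maxLength a N + 1) N
    obtain ⟨l, rfl⟩ := Nat.exists_eq_add_of_le hNN'
    rw [word_prodSub_add] at hc
    have hlen : (factor x 0 (2 * maxLength a N + 1)).length = 2 * maxLength a N + 1 := by
      simp [factor]
    suffices h : (prodSub a n).word b <:+: factor x 0 (2 * maxLength a N + 1) by
      obtain ⟨p, hp1, hp2⟩ := exists_factor_eq_of_infix h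
      exact ⟨p, hp1, by simpa using hp2⟩
    rcases infix_flatMap_decomp _ _ _ hc with ⟨d, hd⟩ | ⟨q, mid, p, d, d', hveq, -, h4, h5⟩
    · have := hd.length_le.trans (length_le_maxLength a N d)
      omega
    · have h6 := h4.length_le.trans (length_le_maxLength a N d)
      have h7 := h5.length_le.trans (length_le_maxLength a N d')
      rcases mid with _ | ⟨e, mid⟩
      · have := congrArg List.length hveq
        simp only [List.flatMap_nil, List.append_nil, List.length_append, hlen] at this
        omega
      · rw [hveq]
        refine (h1 n hn e b).trans ?_
        exact ⟨q, mid.flatMap (prodSub a N).word ++ p, by simp⟩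

/-! ### Growth of the exponential sums -/

/-- If the spectral cocycle grows along `z` with exponent at most `χ`, then the exponential sum over
a factor of length `N` is `O(N ^ β)` for every `β > χ / λ`. -/
lemma exists_norm_wordSum_factor_le [Nonempty (Fin m)] {a : ℕ → Substitution m}
    (ha : ∀ n, (a n).InClass) (hA1 : CondA1' a) {lam : ℝ} (hlam : 0 < lam)
    (hA2 : CondA2 a lam) (hA3 : CondA3 a) {ξ : Fin m → ℝ} {z : Fin m → ℂ} {χ β : ℝ}
    (hχ : 0 < χ) (hz : lyapVec a ξ z ≤ χ) (hβ : χ / lam < β) :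
    ∃ C : ℝ, 0 ≤ C ∧ ∀ x ∈ space a, ∀ (i : ℤ) (L : ℕ),
      ‖wordSum ξ z (factor x i L)‖ ≤ C * (L : ℝ) ^ β := by
  have hβ0 : 0 < β := lt_trans (by positivity) hβ
  rw [div_lt_iff₀ hlam] at hβ
  obtain ⟨ε, hε, hεβ⟩ : ∃ ε : ℝ, 0 < ε ∧ 3 * ε + ε * β = β * lam - χ :=
    ⟨(β * lam - χ) / (3 + β), div_pos (by linarith) (by linarith), by field_simp⟩
  set D : ℕ → ℝ := fun n => vecNorm (cocycle a ξ n *ᵥ z) with hDdef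
  set K : ℕ → ℝ := fun n => ((Finset.univ.sup fun b => ((a n).word b).length : ℕ) : ℝ) with hKdef
  have hD0 : ∀ k, 0 ≤ D k := fun k => NNReal.coe_nonneg _
  have hK0 : ∀ k, 0 ≤ K k := fun k => Nat.cast_nonneg _
  have hD : ∀ k c, ‖wordSum ξ z ((prodSub a k).word c)‖ ≤ D k := by
    intro k c
    have h1 := Finset.single_le_sum (f := fun i => ‖(cocycle a ξ k *ᵥ z) i‖₊)
      (fun i _ => zero_le) (Finset.mem_univ c)
    have h2 : (‖(cocycle a ξ k *ᵥ z) c‖ : ℝ) ≤ D k := by exact_mod_cast h1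
    rwa [cocycle_mulVec] at h2
  have hK : ∀ k c, (((a k).word c).length : ℝ) ≤ K k := by
    intro k c
    simp only [hKdef]
    exact_mod_cast Finset.le_sup (f := fun b => ((a k).word b).length) (Finset.mem_univ c)
  have hDg : ∀ᶠ n : ℕ in atTop, D n ≤ Real.exp ((χ + ε) * n) := by
    apply eventually_le_of_expGrowthSup_lt
    rw [← lyapVec_eq_expGrowthSup]
    exact hz.trans_lt (by exact_mod_cast (by linarith : χ < χ + ε))
  obtain ⟨k₀, hk₀⟩ := eventually_atTop.mp
    ((hDg.and (hA3.eventually_length_le hε)).and (eventually_le_length ha hA1 hlam hA2 hε))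
  set t : ℕ → ℝ := fun k => (if k < k₀ then K k * D k else 0) + Real.exp (-ε * k) with ht
  have ht0 : ∀ k, 0 ≤ t k := by
    intro k
    have := mul_nonneg (hK0 k) (hD0 k)
    simp only [ht]
    split_ifs <;> positivity
  have hsum : Summable t := by
    refine Summable.add (summable_of_ne_finset_zero (s := Finset.range k₀) fun k hk => ?_) ?_
    · rw [if_neg (by simpa using hk)]
    · have := summable_geometric_of_lt_one (Real.exp_nonneg (-ε))
        (by simpa using hε)
      refine this.congr fun k => ?_
      rw [← Real.exp_nat_mul, mul_comm]
  have hDt : ∀ k b, K k * D k ≤ t k * ((prodSub a k).word b).length ^ β := by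
    intro k b
    have hl : (1 : ℝ) ≤ ((prodSub a k).word b).length := by exact_mod_cast one_le_length _ b
    rcases lt_or_ge k k₀ with hk | hk
    · have h1 : (1 : ℝ) ≤ (((prodSub a k).word b).length : ℝ) ^ β :=
        Real.one_le_rpow hl hβ0.le
      have h2 : K k * D k ≤ t k := by
        simp only [ht, if_pos hk]
        have := Real.exp_pos (-ε * k)
        linarith
      exact h2.trans (le_mul_of_one_le_right (ht0 k) h1)
    · obtain ⟨⟨h1, h2⟩, h3⟩ := hk₀ k hk
      have h4 : Real.exp ((lam - ε) * k) ^ β ≤ (((prodSub a k).word b).length : ℝ) ^ β :=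
        Real.rpow_le_rpow (Real.exp_nonneg _) (h3 b) hβ0.le
      rw [← Real.exp_mul] at h4
      calc K k * D k ≤ Real.exp (ε * k) * Real.exp ((χ + ε) * k) := by
            gcongr
        _ = Real.exp (-ε * k) * Real.exp ((lam - ε) * k * β) := by
            rw [← Real.exp_add, ← Real.exp_add]
            congr 1
            linear_combination (k : ℝ) * hεβ
        _ ≤ t k * ((prodSub a k).word b).length ^ β := by
            simp only [ht, if_neg (not_lt.mpr hk), zero_add]
            gcongr
  obtain ⟨Z, hZ⟩ := Finite.exists_le (fun c => ‖z c‖)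
  have hZ0 : 0 ≤ Z := (norm_nonneg _).trans (hZ (Classical.arbitrary _))
  refine ⟨2 * (Z + ∑' k, t k), mul_nonneg zero_le_two (add_nonneg hZ0 (tsum_nonneg ht0)),
    fun x hx i L => ?_⟩
  obtain ⟨N, b, -, hb⟩ := exists_factor_infix ha hx i L 0
  have h1 := norm_wordSum_infix_le hβ0.le hZ hD hK ht0 hDt N b _ hb
  rw [show (factor x i L).length = L by simp [factor]] at h1
  refine h1.trans ?_
  gcongr
  exact hsum.sum_le_tsum _ fun k _ => ht0 k

/-- The exponent of the spectral cocycle along any vector is at most `λ`. -/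
lemma lyapVec_le [Nonempty (Fin m)] {a : ℕ → Substitution m} {lam : ℝ} (hA2 : CondA2 a lam)
    (ξ : Fin m → ℝ) (z : Fin m → ℂ) : lyapVec a ξ z ≤ lam := by
  refine EReal.le_of_forall_lt_iff_le.mp fun c hc => ?_
  have hc' : lam < c := by exact_mod_cast hc
  obtain ⟨Z, hZ⟩ := Finite.exists_le (fun c => ‖z c‖₊)
  rw [lyapVec_eq_expGrowthSup, ← ExpGrowth.expGrowthSup_exp (a := (c : EReal))]
  refine ExpGrowth.expGrowthSup_le_of_eventually_le (b := ((m * Z : ℝ≥0) : ℝ≥0∞))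
    ENNReal.coe_ne_top ?_
  filter_upwards [hA2.eventually_maxLength (sub_pos.mpr hc')] with n hn
  have h1 : ∀ v : List (Fin m), ‖wordSum ξ z v‖₊ ≤ v.length * Z := by
    intro v
    induction v with
    | nil => simp [wordSum]
    | cons d v ih =>
      have h2 : ‖phase (ξ d) * wordSum ξ z v‖₊ = ‖wordSum ξ z v‖₊ := by
        rw [nnnorm_mul, show ‖phase (ξ d)‖₊ = 1 from NNReal.eq (norm_phase _), one_mul]
      refine (nnnorm_add_le _ _).trans ?_
      rw [h2]
      push_cast [List.length_cons]
      rw [add_mul, one_mul, add_comm]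
      exact add_le_add ih (hZ d)
  rw [ereal_exp_coe_mul, cocycle_mulVec]
  have h3 : vecNorm (fun b => wordSum ξ z ((prodSub a n).word b)) ≤ m * Z * maxLength a n := by
    calc _ ≤ ∑ _b : Fin m, (maxLength a n : ℝ≥0) * Z := by
          refine Finset.sum_le_sum fun b _ => (h1 _).trans ?_
          gcongr
          exact length_le_maxLength a n b
      _ = m * Z * maxLength a n := by simp; ring
  refine (ENNReal.coe_le_coe.mpr h3).trans ?_
  rw [ENNReal.coe_mul]
  gcongr
  rw [ENNReal.le_ofReal_iff_toReal_le ENNReal.coe_ne_top (Real.exp_nonneg _)]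
  have := hn.2
  simpa using this

/-! ### Tilings of the line and the suspension flow -/

/-- The function on the line that takes the value `b c` on the tiles of the letter `c`, for the
tiling by intervals of lengths `s` that is coded by `x`. It is `simpleCyl b` along the flow orbit
of `(x, 0)`. -/
def tilingFun (s : Fin m → ℝ) (b : Fin m → ℂ) (x : ℤ → Fin m) (r : ℝ) : ℂ :=
  b (x (tileIndex s x r))

lemma cocycleSum_strictMono {s : Fin m → ℝ} (hs : ∀ j, 0 < s j) (x : ℤ → Fin m) :
    StrictMono (cocycleSum s x) := by
  refine strictMono_int_of_lt_succ fun n => ?_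
  rw [cocycleSum_succ]
  linarith [hs (x n)]

lemma tileIndex_eq_iff {s : Fin m → ℝ} (hs : ∀ j, 0 < s j) (x : ℤ → Fin m) (r : ℝ) (n : ℤ) :
    tileIndex s x r = n ↔ cocycleSum s x n ≤ r ∧ r < cocycleSum s x (n + 1) := by
  obtain ⟨h1, h2⟩ := tileIndex_spec hs x r
  have hm := cocycleSum_strictMono hs x
  refine ⟨fun h => h ▸ ⟨h1, h2⟩, fun ⟨h3, h4⟩ => ?_⟩
  have h5 := hm.lt_iff_lt.mp (h1.trans_lt h4)
  have h6 := hm.lt_iff_lt.mp (h3.trans_lt h2)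
  omega

lemma cocycleSum_shift_one (s : Fin m → ℝ) (x : ℤ → Fin m) (n : ℤ) :
    cocycleSum s (shift 1 x) n = cocycleSum s x (n + 1) - s (x 0) := by
  have h0 : cocycleSum s x (0 + 1) = s (x 0) := by
    rw [cocycleSum_succ, cocycleSum_zero, zero_add]
  induction n using Int.induction_on with
  | zero => rw [cocycleSum_zero, h0, sub_self]
  | succ n ih =>
    rw [cocycleSum_succ, ih, cocycleSum_succ s x (n + 1)]
    simp only [shift]
    ring
  | pred n ih =>
    have h1 := cocycleSum_succ s (shift 1 x) (-(n : ℤ) - 1)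
    have h2 := cocycleSum_succ s x (-(n : ℤ) - 1 + 1)
    rw [sub_add_cancel] at h1 h2
    rw [sub_add_cancel]
    simp only [shift, sub_add_cancel] at h1
    linarith

lemma tilingFun_shift_one {s : Fin m → ℝ} (hs : ∀ j, 0 < s j) (b : Fin m → ℂ) (x : ℤ → Fin m)
    (r : ℝ) : tilingFun s b (shift 1 x) r = tilingFun s b x (r + s (x 0)) := by
  have h : tileIndex s x (r + s (x 0)) = tileIndex s (shift 1 x) r + 1 := by
    rw [tileIndex_eq_iff hs]
    obtain ⟨h1, h2⟩ := tileIndex_spec hs (shift 1 x) r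
    rw [cocycleSum_shift_one] at h1 h2
    constructor <;> linarith
  rw [tilingFun, tilingFun, h]
  rfl

lemma tilingFun_of_mem {s : Fin m → ℝ} (hs : ∀ j, 0 < s j) (b : Fin m → ℂ) {x : ℤ → Fin m}
    {n : ℤ} {r : ℝ} (h1 : cocycleSum s x n ≤ r) (h2 : r < cocycleSum s x (n + 1)) :
    tilingFun s b x r = b (x n) := by
  rw [tilingFun, (tileIndex_eq_iff hs x r n).mpr ⟨h1, h2⟩]

lemma simpleCyl_flow (s : Fin m → ℝ) (b : Fin m → ℂ) (τ : ℝ) (p : (ℤ → Fin m) × ℝ) :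
    simpleCyl b (flow s τ p) = tilingFun s b p.1 (p.2 + τ) := by
  simp [simpleCyl, flow, tilingFun, shift]

lemma measurable_cocycleSum (s : Fin m → ℝ) (n : ℤ) :
    Measurable fun x : ℤ → Fin m => cocycleSum s x n := by
  unfold cocycleSum
  have h : ∀ k : ℤ, Measurable fun x : ℤ → Fin m => s (x k) := fun k =>
    (measurable_of_finite s).comp (measurable_pi_apply k)
  exact (Finset.measurable_fun_sum _ fun k _ => h k).sub
    (Finset.measurable_fun_sum _ fun k _ => h k)

lemma measurable_tilingFun {s : Fin m → ℝ} (hs : ∀ j, 0 < s j) (b : Fin m → ℂ) :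
    Measurable fun p : (ℤ → Fin m) × ℝ => tilingFun s b p.1 p.2 := by
  have h1 : Measurable fun p : (ℤ → Fin m) × ℝ => tileIndex s p.1 p.2 := by
    refine measurable_to_countable' fun n => ?_
    have : (fun p : (ℤ → Fin m) × ℝ => tileIndex s p.1 p.2) ⁻¹' {n} =
        {p | cocycleSum s p.1 n ≤ p.2} ∩ {p | p.2 < cocycleSum s p.1 (n + 1)} := by
      ext p
      exact tileIndex_eq_iff hs p.1 p.2 n
    rw [this]
    exact (measurableSet_le ((measurable_cocycleSum s n).comp measurable_fst)
      measurable_snd).inter (measurableSet_lt measurable_snd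
      ((measurable_cocycleSum s (n + 1)).comp measurable_fst))
  have h2 : Measurable fun p : (ℤ → Fin m) × ℤ => b (p.1 p.2) :=
    measurable_from_prod_countable_left fun n =>
      (measurable_of_finite b).comp (measurable_pi_apply n)
  exact h2.comp (measurable_fst.prodMk h1)

lemma measurable_shift (n : ℤ) : Measurable (shift (m := m) n) :=
  measurable_pi_lambda _ fun _ => measurable_pi_apply _

lemma intervalIntegrable_of_norm_le {E : Type*} [NormedAddCommGroup E] {f : ℝ → E}
    (hf : StronglyMeasurable f) {C : ℝ}
    (hC : ∀ r, ‖f r‖ ≤ C) (u v : ℝ) : IntervalIntegrable f volume u v :=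
  ⟨Integrable.of_bound hf.aestronglyMeasurable C (Eventually.of_forall hC),
    Integrable.of_bound hf.aestronglyMeasurable C (Eventually.of_forall hC)⟩

section Suspension

variable {E : Type*} [NormedAddCommGroup E] [NormedSpace ℝ E]

lemma stronglyMeasurable_intervalIntegral {X : Type*} [MeasurableSpace X] {P : X → ℝ → E}
    (hP : StronglyMeasurable (Function.uncurry P)) {h : X → ℝ} (hh : Measurable h) :
    StronglyMeasurable fun x => ∫ t in (0 : ℝ)..h x, P x t := by
  have key : ∀ S : Set (X × ℝ), MeasurableSet S →
      StronglyMeasurable fun x => ∫ t in {t | (x, t) ∈ S}, P x t := by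
    intro S hS
    have h1 := (hP.indicator hS).integral_prod_right' (ν := (volume : Measure ℝ))
    convert h1 using 2 with x
    have h2 : MeasurableSet {t | (x, t) ∈ S} := measurable_prodMk_left hS
    rw [← integral_indicator h2]
    rfl
  simp only [intervalIntegral]
  refine (key {p | p.2 ∈ Set.Ioc 0 (h p.1)} ?_).sub (key {p | p.2 ∈ Set.Ioc (h p.1) 0} ?_)
  · exact (measurableSet_lt measurable_const measurable_snd).inter
      (measurableSet_le measurable_snd (hh.comp measurable_fst))
  · exact (measurableSet_lt (hh.comp measurable_fst) measurable_snd).inter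
      (measurableSet_le measurable_snd measurable_const)

lemma integrable_intervalIntegral {X : Type*} [MeasurableSpace X] {μ : Measure X}
    [IsFiniteMeasure μ] {P : X → ℝ → E} (hP : StronglyMeasurable (Function.uncurry P)) {C : ℝ}
    (hC : ∀ x r, ‖P x r‖ ≤ C) {h : X → ℝ} (hh : Measurable h) {H : ℝ} (hH : ∀ x, |h x| ≤ H) :
    Integrable (fun x => ∫ t in (0 : ℝ)..h x, P x t) μ := by
  refine Integrable.of_bound (stronglyMeasurable_intervalIntegral hP hh).aestronglyMeasurable
    (C * H) (Eventually.of_forall fun x => ?_)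
  refine (intervalIntegral.norm_integral_le_of_norm_le_const fun t _ => hC x t).trans ?_
  rw [sub_zero]
  have hC0 : 0 ≤ C := (norm_nonneg _).trans (hC x 0)
  exact mul_le_mul_of_nonneg_left (hH x) hC0

variable {a : ℕ → Substitution m} {s : Fin m → ℝ} {μ : Measure (ℤ → Fin m)}

lemma measurable_roof (s : Fin m → ℝ) : Measurable fun x : ℤ → Fin m => s (x 0) :=
  (measurable_of_finite s).comp (measurable_pi_apply 0)

lemma suspensionMeasure_eq [IsProbabilityMeasure μ] (hμX : ∀ᵐ x ∂μ, x ∈ space a) :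
    suspensionMeasure a s μ = (μ.prod volume).restrict {p | 0 ≤ p.2 ∧ p.2 < s (p.1 0)} := by
  refine Measure.restrict_congr_set ?_
  filter_upwards [Measure.quasiMeasurePreserving_fst.ae hμX] with p hp
  exact propext ⟨fun h => h.2, fun h => ⟨hp, h⟩⟩

lemma isFiniteMeasure_suspensionMeasure [IsProbabilityMeasure μ] (a : ℕ → Substitution m)
    (s : Fin m → ℝ) : IsFiniteMeasure (suspensionMeasure a s μ) := by
  obtain ⟨S, hS⟩ := Finite.exists_le s
  refine ⟨?_⟩
  rw [suspensionMeasure, Measure.restrict_apply_univ]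
  refine (measure_mono (t := Set.univ ×ˢ Set.Icc 0 S) ?_).trans_lt ?_
  · exact fun p hp => ⟨trivial, hp.2.1, hp.2.2.le.trans (hS _)⟩
  · rw [Measure.prod_prod]
    exact ENNReal.mul_lt_top (measure_lt_top _ _) (by simp)

lemma integral_suspensionMeasure [IsProbabilityMeasure μ] (hμX : ∀ᵐ x ∂μ, x ∈ space a)
    (hs : ∀ j, 0 < s j) {F : (ℤ → Fin m) × ℝ → E} (hF : StronglyMeasurable F) {C : ℝ}
    (hC : ∀ p, ‖F p‖ ≤ C) :
    ∫ p, F p ∂(suspensionMeasure a s μ) = ∫ x, (∫ t in (0 : ℝ)..s (x 0), F (x, t)) ∂μ := by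
  have hU : MeasurableSet {p : (ℤ → Fin m) × ℝ | 0 ≤ p.2 ∧ p.2 < s (p.1 0)} :=
    (measurableSet_le measurable_const measurable_snd).inter
      (measurableSet_lt measurable_snd ((measurable_roof s).comp measurable_fst))
  have := isFiniteMeasure_suspensionMeasure (μ := μ) a s
  have hint : Integrable F (suspensionMeasure a s μ) :=
    Integrable.of_bound hF.aestronglyMeasurable C (Eventually.of_forall hC)
  rw [suspensionMeasure_eq hμX] at hint ⊢
  rw [← integral_indicator hU, integral_prod _ ((integrable_indicator_iff hU).mpr hint)]
  refine integral_congr_ae (Eventually.of_forall fun x => ?_)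
  simp only
  rw [intervalIntegral.integral_of_le (hs _).le, ← integral_Ico_eq_integral_Ioc,
    ← integral_indicator measurableSet_Ico]
  rfl

variable {P : (ℤ → Fin m) → ℝ → E}

lemma integral_comp_shift (hμT : MeasurePreserving (shift 1) μ μ) {Φ : (ℤ → Fin m) → E}
    (hΦ : StronglyMeasurable Φ) : ∫ x, Φ (shift 1 x) ∂μ = ∫ x, Φ x ∂μ := by
  have h := integral_map (μ := μ) hμT.measurable.aemeasurable (f := Φ)
    hΦ.aestronglyMeasurable
  rw [hμT.map_eq] at h
  exact h.symm

/-- Invariance of the suspension measure under the flow: the two sides differ by the integral of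
the coboundary `Φ ∘ T - Φ` with `Φ x = ∫₀^τ P x`. -/
lemma integral_roof_translate [IsProbabilityMeasure μ] (hμT : MeasurePreserving (shift 1) μ μ)
    (hP : StronglyMeasurable (Function.uncurry P)) {C : ℝ} (hC : ∀ x r, ‖P x r‖ ≤ C)
    (hPT : ∀ x r, P (shift 1 x) r = P x (r + s (x 0))) (τ : ℝ) :
    ∫ x, (∫ t in (0 : ℝ)..s (x 0), P x (t + τ)) ∂μ = ∫ x, (∫ t in (0 : ℝ)..s (x 0), P x t) ∂μ := by
  obtain ⟨S, hS⟩ := Finite.exists_le fun j => |s j|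
  have hi : ∀ x u v, IntervalIntegrable (P x) volume u v := fun x u v =>
    intervalIntegrable_of_norm_le (hP.comp_measurable measurable_prodMk_left) (hC x) u v
  have h1 : ∀ x, ∫ t in (0 : ℝ)..s (x 0), P x (t + τ) = (∫ t in (0 : ℝ)..s (x 0), P x t) +
      ((∫ t in (0 : ℝ)..τ, P (shift 1 x) t) - ∫ t in (0 : ℝ)..τ, P x t) := by
    intro x
    simp only [hPT]
    rw [intervalIntegral.integral_comp_add_right, intervalIntegral.integral_comp_add_right,
      zero_add, zero_add, intervalIntegral.integral_interval_sub_left (hi ..) (hi ..) |>.symm]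
    rw [← intervalIntegral.integral_interval_sub_left (hi x 0 (τ + s (x 0))) (hi x 0 (s (x 0)))]
    rw [add_comm τ]
    abel
  have hτ : ∀ x : ℤ → Fin m, |(fun _ => τ) x| ≤ |τ| := fun _ => le_rfl
  have h2 : Integrable (fun x => ∫ t in (0 : ℝ)..τ, P x t) μ :=
    integrable_intervalIntegral hP hC measurable_const hτ
  have h3 : Integrable (fun x => ∫ t in (0 : ℝ)..τ, P (shift 1 x) t) μ := by
    refine integrable_intervalIntegral (P := fun x => P (shift 1 x)) ?_ (fun x => hC _)
      measurable_const hτ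
    exact hP.comp_measurable (((measurable_shift 1).comp measurable_fst).prodMk measurable_snd)
  have h4 : Integrable (fun x => (∫ t in (0 : ℝ)..τ, P (shift 1 x) t) -
      ∫ t in (0 : ℝ)..τ, P x t) μ := h3.sub h2
  simp only [h1]
  rw [integral_add (integrable_intervalIntegral hP hC (measurable_roof s) fun x => hS _) h4,
    integral_sub h3 h2,
    integral_comp_shift hμT (stronglyMeasurable_intervalIntegral hP measurable_const)]
  simp

/-- The integral over the suspension is the average over `W` consecutive tiles. -/
lemma integral_cocycleSum [IsProbabilityMeasure μ] (hμT : MeasurePreserving (shift 1) μ μ)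
    (hP : StronglyMeasurable (Function.uncurry P)) {C : ℝ} (hC : ∀ x r, ‖P x r‖ ≤ C)
    (hPT : ∀ x r, P (shift 1 x) r = P x (r + s (x 0))) (W : ℕ) :
    ∫ x, (∫ t in (0 : ℝ)..cocycleSum s x W, P x t) ∂μ =
      W • ∫ x, (∫ t in (0 : ℝ)..s (x 0), P x t) ∂μ := by
  obtain ⟨S, hS⟩ := Finite.exists_le fun j => |s j|
  have hi : ∀ x u v, IntervalIntegrable (P x) volume u v := fun x u v =>
    intervalIntegrable_of_norm_le (hP.comp_measurable measurable_prodMk_left) (hC x) u v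
  have hb : ∀ (n : ℕ) (x : ℤ → Fin m), |cocycleSum s x n| ≤ n * S := by
    intro n x
    induction n with
    | zero => simp [cocycleSum_zero]
    | succ n ih =>
      push_cast
      rw [cocycleSum_succ]
      refine (abs_add_le _ _).trans ?_
      linarith [hS (x n)]
  induction W with
  | zero => simp [cocycleSum_zero]
  | succ W ih =>
    have h1 : ∀ x, ∫ t in (0 : ℝ)..cocycleSum s x (W + 1 : ℕ), P x t =
        (∫ t in (0 : ℝ)..s (x 0), P x t) +
          ∫ t in (0 : ℝ)..cocycleSum s (shift 1 x) W, P (shift 1 x) t := by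
      intro x
      simp only [hPT]
      rw [intervalIntegral.integral_comp_add_right, cocycleSum_shift_one, sub_add_cancel, zero_add,
        intervalIntegral.integral_add_adjacent_intervals (hi ..) (hi ..)]
      norm_cast
    have hm := stronglyMeasurable_intervalIntegral hP (measurable_cocycleSum s W)
    have h2 : Integrable (fun x => ∫ t in (0 : ℝ)..cocycleSum s (shift 1 x) W,
        P (shift 1 x) t) μ :=
      integrable_intervalIntegral (P := fun x => P (shift 1 x))
        (hP.comp_measurable (((measurable_shift 1).comp measurable_fst).prodMk measurable_snd))
        (fun x => hC _) ((measurable_cocycleSum s W).comp (measurable_shift 1))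
        (fun x => hb W _)
    simp only [h1]
    rw [integral_add (integrable_intervalIntegral hP hC (measurable_roof s) fun x => hS _) h2,
      integral_comp_shift hμT hm, ih, succ_nsmul']

end Suspension

/-! ### Twisted integrals and the spectral measure -/

lemma conj_phase (x : ℝ) : (starRingEnd ℂ) (phase x) = phase (-x) := by
  unfold phase
  rw [← Complex.exp_conj]
  have h : (starRingEnd ℂ) 2 = 2 := Complex.conj_ofNat 2
  simp [h]

lemma stronglyMeasurable_conj {X : Type*} [MeasurableSpace X] {f : X → ℂ}
    (hf : StronglyMeasurable f) : StronglyMeasurable fun x => (starRingEnd ℂ) (f x) :=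
  Complex.continuous_conj.comp_stronglyMeasurable hf

/-- The squared modulus of an average of the functions `F (·) τ` integrates to the average of
their correlations. -/
lemma integral_norm_sq_integral {Y : Type*} [MeasurableSpace Y] (ν : Measure Y)
    [IsFiniteMeasure ν] (ρ : Measure ℝ) [IsFiniteMeasure ρ] {F : Y → ℝ → ℂ}
    (hF : StronglyMeasurable (Function.uncurry F)) {C : ℝ} (hC : ∀ y τ, ‖F y τ‖ ≤ C) :
    ((∫ y, ‖∫ τ, F y τ ∂ρ‖ ^ 2 ∂ν : ℝ) : ℂ) =
      ∫ p, (∫ y, F y p.1 * (starRingEnd ℂ) (F y p.2) ∂ν) ∂(ρ.prod ρ) := by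
  have h1 : ∀ y, ((‖∫ τ, F y τ ∂ρ‖ ^ 2 : ℝ) : ℂ) =
      ∫ p, F y p.1 * (starRingEnd ℂ) (F y p.2) ∂(ρ.prod ρ) := by
    intro y
    rw [integral_prod_mul (F y) (fun τ => (starRingEnd ℂ) (F y τ)), integral_conj,
      Complex.mul_conj, Complex.normSq_eq_norm_sq]
  rw [← integral_complex_ofReal]
  simp only [h1]
  refine integral_integral_swap ?_
  refine Integrable.of_bound (C := C * C) (StronglyMeasurable.aestronglyMeasurable ?_)
    (Eventually.of_forall fun q => ?_)
  · have e1 : Measurable fun q : Y × ℝ × ℝ => (q.1, q.2.1) := by fun_prop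
    have e2 : Measurable fun q : Y × ℝ × ℝ => (q.1, q.2.2) := by fun_prop
    exact (hF.comp_measurable e1).mul (stronglyMeasurable_conj (hF.comp_measurable e2))
  · have hC0 : 0 ≤ C := (norm_nonneg _).trans (hC q.1 0)
    simp only [Function.uncurry, norm_mul, RCLike.norm_conj]
    exact mul_le_mul (hC _ _) (hC _ _) (norm_nonneg _) hC0

/-- The mean square over the suspension of the twisted integrals
`∫₀^L f(h_τ y) exp (-2πi ω τ) dτ` of the cylindrical function `f` with values `b`. -/
def meanSq (s : Fin m → ℝ) (μ : Measure (ℤ → Fin m)) (b : Fin m → ℂ) (ω L : ℝ) : ℝ :=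
  ∫ x, (∫ t in (0 : ℝ)..s (x 0),
    ‖∫ τ in (0 : ℝ)..L, tilingFun s b x (t + τ) * phase (ω * τ)‖ ^ 2) ∂μ

/-- The Fejér-type kernel `|∫₀^L exp (-2πi x τ) dτ|²`. -/
def fejer (L x : ℝ) : ℝ := ‖∫ τ in (0 : ℝ)..L, phase (x * τ)‖ ^ 2

lemma exists_norm_tilingFun_le (s : Fin m → ℝ) (b : Fin m → ℂ) :
    ∃ B, 0 ≤ B ∧ ∀ x r, ‖tilingFun s b x r‖ ≤ B := by
  obtain ⟨B, hB⟩ := Finite.exists_le fun c => ‖b c‖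
  exact ⟨max B 0, le_max_right _ _, fun x r => (hB _).trans (le_max_left _ _)⟩

lemma integral_correlation {a : ℕ → Substitution m} {s : Fin m → ℝ} {μ : Measure (ℤ → Fin m)}
    [IsProbabilityMeasure μ] (hμX : ∀ᵐ x ∂μ, x ∈ space a)
    (hμT : MeasurePreserving (shift 1) μ μ) (hs : ∀ j, 0 < s j) (b : Fin m → ℂ) (τ τ' : ℝ) :
    ∫ p, tilingFun s b p.1 (p.2 + τ) * (starRingEnd ℂ) (tilingFun s b p.1 (p.2 + τ'))
        ∂(suspensionMeasure a s μ) =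
      ∫ p, simpleCyl b (flow s (τ - τ') p) * (starRingEnd ℂ) (simpleCyl b p)
        ∂(suspensionMeasure a s μ) := by
  obtain ⟨B, hB0, hB⟩ := exists_norm_tilingFun_le s b
  have hg : ∀ u : ℝ, StronglyMeasurable fun p : (ℤ → Fin m) × ℝ =>
      tilingFun s b p.1 (p.2 + u) := fun u => by
    have e : Measurable fun p : (ℤ → Fin m) × ℝ => (p.1, p.2 + u) := by fun_prop
    exact ((measurable_tilingFun hs b).comp e).stronglyMeasurable
  have hcyl : StronglyMeasurable fun p : (ℤ → Fin m) × ℝ => simpleCyl b p :=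
    ((measurable_of_finite b).comp
      ((measurable_pi_apply 0).comp measurable_fst)).stronglyMeasurable
  have hmul : ∀ {u v : ℂ}, ‖u‖ ≤ B → ‖v‖ ≤ B → ‖u * (starRingEnd ℂ) v‖ ≤ B * B := by
    intro u v hu hv
    rw [norm_mul, RCLike.norm_conj]
    exact mul_le_mul hu hv (norm_nonneg _) hB0
  have hcylB : ∀ p : (ℤ → Fin m) × ℝ, ‖simpleCyl b p‖ ≤ B := by
    intro p
    have := hB p.1 0
    rwa [tilingFun_of_mem hs b (n := 0) (by rw [cocycleSum_zero])
      (by rw [cocycleSum_succ, cocycleSum_zero, zero_add]; exact hs _)] at this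
  rw [integral_suspensionMeasure hμX hs (F := fun p => tilingFun s b p.1 (p.2 + τ) *
    (starRingEnd ℂ) (tilingFun s b p.1 (p.2 + τ'))) ((hg τ).mul (stronglyMeasurable_conj (hg τ')))
    (C := B * B) (fun p => hmul (hB _ _) (hB _ _))]
  simp only [simpleCyl_flow]
  rw [integral_suspensionMeasure hμX hs (F := fun p => tilingFun s b p.1 (p.2 + (τ - τ')) *
    (starRingEnd ℂ) (simpleCyl b p)) ((hg _).mul (stronglyMeasurable_conj hcyl))
    (C := B * B) (fun p => hmul (hB _ _) (hcylB _))]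
  have key := integral_roof_translate (s := s) (μ := μ) hμT (C := B * B)
    (P := fun x r => tilingFun s b x (r + (τ - τ')) * (starRingEnd ℂ) (tilingFun s b x r))
    ((hg (τ - τ')).mul (stronglyMeasurable_conj (measurable_tilingFun hs b).stronglyMeasurable))
    (fun x r => hmul (hB _ _) (hB _ _))
    (fun x r => by
      rw [tilingFun_shift_one hs, tilingFun_shift_one hs]
      ring_nf) τ'
  simp only [add_assoc, add_sub_cancel] at key
  rw [key]
  refine integral_congr_ae (Eventually.of_forall fun x => ?_)
  simp only
  rw [intervalIntegral.integral_of_le (hs _).le, intervalIntegral.integral_of_le (hs _).le,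
    ← integral_Ico_eq_integral_Ioc, ← integral_Ico_eq_integral_Ioc]
  refine setIntegral_congr_fun measurableSet_Ico fun t ht => ?_
  rw [tilingFun_of_mem hs b (n := 0) (r := t) (by rw [cocycleSum_zero]; exact ht.1)
      (by rw [cocycleSum_succ, cocycleSum_zero, zero_add]; exact ht.2)]
  rfl

/-- The mean square of the twisted integrals is the convolution of the spectral measure with the
Fejér-type kernel. -/
lemma meanSq_eq_integral_fejer {a : ℕ → Substitution m} {s : Fin m → ℝ}
    {μ : Measure (ℤ → Fin m)} [IsProbabilityMeasure μ] (hμX : ∀ᵐ x ∂μ, x ∈ space a)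
    (hμT : MeasurePreserving (shift 1) μ μ) (hs : ∀ j, 0 < s j) (b : Fin m → ℂ) {σ : Measure ℝ}
    (hσ : IsSpectralMeasure (flow s) (suspensionMeasure a s μ) (simpleCyl b) σ) (ω : ℝ) {L : ℝ}
    (hL : 0 ≤ L) : meanSq s μ b ω L = ∫ θ, fejer L (ω - θ) ∂σ := by
  obtain ⟨B, hB0, hB⟩ := exists_norm_tilingFun_le s b
  have := hσ.1
  have := isFiniteMeasure_suspensionMeasure (μ := μ) a s
  set ρ : Measure ℝ := volume.restrict (Set.Ioc 0 L) with hρ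
  set F : (ℤ → Fin m) × ℝ → ℝ → ℂ := fun p τ => tilingFun s b p.1 (p.2 + τ) * phase (ω * τ)
    with hF
  set G : ℝ → ℝ → ℂ := fun θ τ => phase ((ω - θ) * τ) with hG
  have hFm : StronglyMeasurable (Function.uncurry F) := by
    have e : Measurable fun q : ((ℤ → Fin m) × ℝ) × ℝ => (q.1.1, q.1.2 + q.2) := by fun_prop
    have e2 : Measurable fun q : ((ℤ → Fin m) × ℝ) × ℝ => ω * q.2 := by fun_prop
    exact (((measurable_tilingFun hs b).comp e).mul
      (continuous_phase.measurable.comp e2)).stronglyMeasurable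
  have hFB : ∀ p τ, ‖F p τ‖ ≤ B := by
    intro p τ
    rw [hF, norm_mul, norm_phase, mul_one]
    exact hB _ _
  have hGm : StronglyMeasurable (Function.uncurry G) := by
    refine Continuous.stronglyMeasurable (continuous_phase.comp ?_)
    fun_prop
  have hGB : ∀ θ τ, ‖G θ τ‖ ≤ 1 := fun θ τ => (norm_phase _).le
  have hcorr : ∀ p : ℝ × ℝ, ∫ y, F y p.1 * (starRingEnd ℂ) (F y p.2) ∂(suspensionMeasure a s μ) =
      ∫ θ, G θ p.1 * (starRingEnd ℂ) (G θ p.2) ∂σ := by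
    rintro ⟨τ, τ'⟩
    have h1 : ∀ y, F y τ * (starRingEnd ℂ) (F y τ') = (tilingFun s b y.1 (y.2 + τ) *
        (starRingEnd ℂ) (tilingFun s b y.1 (y.2 + τ'))) * phase (ω * (τ - τ')) := by
      intro y
      simp only [hF, map_mul, conj_phase]
      rw [show ω * (τ - τ') = ω * τ + -(ω * τ') by ring, phase_add]
      ring
    have h2 : ∀ θ, G θ τ * (starRingEnd ℂ) (G θ τ') =
        Complex.exp (2 * Real.pi * Complex.I * θ * (τ - τ' : ℝ)) * phase (ω * (τ - τ')) := by
      intro θ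
      simp only [hG, conj_phase]
      rw [← phase_add, show (ω - θ) * τ + -((ω - θ) * τ') = -θ * (τ - τ') + ω * (τ - τ') by ring,
        phase_add]
      congr 1
      simp only [phase]
      congr 1
      push_cast
      ring
    simp only [h1, h2]
    rw [integral_mul_const, integral_mul_const, integral_correlation hμX hμT hs, ← hσ.2]
  have h1 := integral_norm_sq_integral (suspensionMeasure a s μ) ρ hFm hFB
  have h2 := integral_norm_sq_integral σ ρ hGm hGB
  simp only [hcorr] at h1
  rw [← h2] at h1
  have h3 := Complex.ofReal_injective h1
  have hInt : StronglyMeasurable fun p => ‖∫ τ, F p τ ∂ρ‖ ^ 2 :=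
    (hFm.integral_prod_right' (ν := ρ)).norm.pow 2
  rw [integral_suspensionMeasure hμX hs hInt (C := (B * ρ.real Set.univ) ^ 2)] at h3
  · simp only [meanSq, fejer, intervalIntegral.integral_of_le hL]
    exact h3
  · intro p
    rw [Real.norm_of_nonneg (by positivity)]
    gcongr
    exact norm_integral_le_of_norm_le_const (Eventually.of_forall fun τ => hFB p τ)

/-! ### The Fejér-type kernel -/

lemma fejer_le_sq {L : ℝ} (hL : 0 ≤ L) (x : ℝ) : fejer L x ≤ L ^ 2 := by
  unfold fejer
  have h : ‖∫ τ in (0 : ℝ)..L, phase (x * τ)‖ ≤ 1 * |L - 0| :=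
    intervalIntegral.norm_integral_le_of_norm_le_const fun τ _ => (norm_phase _).le
  rw [one_mul, sub_zero, abs_of_nonneg hL] at h
  gcongr

lemma phase_mul_eq_exp (x τ : ℝ) :
    phase (x * τ) = Complex.exp ((-2 * Real.pi * Complex.I * x) * τ) := by
  unfold phase
  congr 1
  push_cast
  ring

lemma integral_phase {ω : ℝ} (hω : ω ≠ 0) (u v : ℝ) :
    ∫ r in u..v, phase (ω * r) =
      (phase (ω * u) - phase (ω * v)) / (2 * Real.pi * Complex.I * ω) := by
  have hc : (-2 * Real.pi * Complex.I * ω : ℂ) ≠ 0 := by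
    simp [hω, Real.pi_ne_zero]
  simp only [phase_mul_eq_exp]
  rw [integral_exp_mul_complex hc, show (-2 * Real.pi * Complex.I * ω : ℂ) =
    -(2 * Real.pi * Complex.I * ω) by ring, div_neg, ← neg_div, neg_sub]

lemma fejer_mul_sq_le (L x : ℝ) : fejer L x * x ^ 2 ≤ 1 := by
  rcases eq_or_ne x 0 with rfl | hx
  · simp
  have h1 : ‖(phase (x * 0) - phase (x * L))‖ ≤ 2 := by
    refine (norm_sub_le _ _).trans ?_
    rw [norm_phase, norm_phase]
    norm_num
  have h2 : ‖(2 * Real.pi * Complex.I * x : ℂ)‖ = 2 * Real.pi * |x| := by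
    simp [abs_of_pos Real.pi_pos]
  have h3 : ‖∫ τ in (0 : ℝ)..L, phase (x * τ)‖ * |x| ≤ 1 := by
    rw [integral_phase hx, norm_div, h2, div_mul_eq_mul_div, div_le_one
      (by have := Real.pi_pos; positivity)]
    have := Real.pi_gt_three
    nlinarith [abs_nonneg x]
  calc fejer L x * x ^ 2 = (‖∫ τ in (0 : ℝ)..L, phase (x * τ)‖ * |x|) ^ 2 := by
        rw [fejer, mul_pow, sq_abs]
    _ ≤ 1 := pow_le_one₀ (by positivity) h3

lemma phase_re (x : ℝ) : (phase x).re = Real.cos (2 * Real.pi * x) := by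
  have : (-2 * Real.pi * Complex.I * (x : ℝ) : ℂ) =
      ((-(2 * Real.pi * x) : ℝ) : ℂ) * Complex.I := by push_cast; ring
  rw [phase, this, Complex.exp_ofReal_mul_I_re, Real.cos_neg]

lemma le_fejer {L x : ℝ} (hL : 0 ≤ L) (hx : |x| * (8 * L) ≤ 1) : L ^ 2 / 4 ≤ fejer L x := by
  have hint : IntervalIntegrable (fun τ => phase (x * τ)) volume 0 L :=
    (continuous_phase.comp (by fun_prop : Continuous fun τ : ℝ => x * τ)).intervalIntegrable _ _
  have h1 : (∫ τ in (0 : ℝ)..L, phase (x * τ)).re =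
      ∫ τ in (0 : ℝ)..L, Real.cos (2 * Real.pi * (x * τ)) := by
    have := Complex.reCLM.intervalIntegral_comp_comm hint
    simp only [Complex.reCLM_apply, phase_re] at this
    exact this.symm
  have h2 : L / 2 ≤ ∫ τ in (0 : ℝ)..L, Real.cos (2 * Real.pi * (x * τ)) := by
    have h3 : ∫ _τ in (0 : ℝ)..L, (1 / 2 : ℝ) = L / 2 := by simp; ring
    rw [← h3]
    refine intervalIntegral.integral_mono_on hL (by simp)
      (Continuous.intervalIntegrable (by fun_prop) _ _) fun τ hτ => ?_
    have h4 := Real.one_sub_sq_div_two_le_cos (x := 2 * Real.pi * (x * τ))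
    have h5 : |2 * Real.pi * (x * τ)| ≤ 1 := by
      rw [abs_mul (2 * Real.pi), abs_mul x, abs_of_nonneg hτ.1,
        abs_of_pos (by positivity : 0 < 2 * Real.pi)]
      have h6 : |x| * τ ≤ |x| * L := by gcongr; exact hτ.2
      have h7 := Real.pi_lt_four
      have h8 := Real.pi_pos
      have h9 : 0 ≤ |x| * τ := mul_nonneg (abs_nonneg _) hτ.1
      nlinarith
    have h6 := (sq_le_one_iff_abs_le_one _).mpr h5
    linarith
  have h3 : L / 2 ≤ ‖∫ τ in (0 : ℝ)..L, phase (x * τ)‖ := by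
    refine h2.trans ?_
    rw [← h1]
    exact (le_abs_self _).trans (Complex.abs_re_le_norm _)
  calc L ^ 2 / 4 = (L / 2) ^ 2 := by ring
    _ ≤ fejer L x := by unfold fejer; gcongr

lemma continuous_fejer (L : ℝ) : Continuous (fejer L) := by
  unfold fejer
  refine (Continuous.norm ?_).pow 2
  exact intervalIntegral.continuous_parametric_intervalIntegral_of_continuous'
    (f := fun x τ => phase (x * τ))
    (continuous_phase.comp (by fun_prop : Continuous fun p : ℝ × ℝ => p.1 * p.2)) 0 L

lemma integrable_fejer (σ : Measure ℝ) [IsFiniteMeasure σ] {L : ℝ} (hL : 0 ≤ L) (ω : ℝ) :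
    Integrable (fun θ => fejer L (ω - θ)) σ := by
  refine Integrable.of_bound (C := L ^ 2)
    ((continuous_fejer L).comp (by fun_prop)).aestronglyMeasurable
    (Eventually.of_forall fun θ => ?_)
  rw [Real.norm_of_nonneg (show 0 ≤ fejer L (ω - θ) from sq_nonneg _)]
  exact fejer_le_sq hL _

/-- The mass of a ball of radius `1 / (8 L)` is controlled by the Fejér mean at scale `L`. -/
lemma measureReal_ball_mul_le (σ : Measure ℝ) [IsFiniteMeasure σ] {L : ℝ} (hL : 0 < L) (ω : ℝ) :
    σ.real (Metric.ball ω (1 / (8 * L))) * (L ^ 2 / 4) ≤ ∫ θ, fejer L (ω - θ) ∂σ := by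
  have h1 : ∫ θ, (Metric.ball ω (1 / (8 * L))).indicator (fun _ => L ^ 2 / 4) θ ∂σ =
      σ.real (Metric.ball ω (1 / (8 * L))) * (L ^ 2 / 4) := by
    rw [integral_indicator_const _ measurableSet_ball, smul_eq_mul]
  rw [← h1]
  refine integral_mono ((integrable_const _).indicator measurableSet_ball)
    (integrable_fejer σ hL.le ω) fun θ => ?_
  refine Set.indicator_apply_le' (fun hθ => le_fejer hL.le ?_) fun _ => sq_nonneg _
  rw [Metric.mem_ball', Real.dist_eq, lt_div_iff₀ (by positivity)] at hθ
  exact hθ.le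

lemma le_one_add_sum_indicator (ω θ : ℝ) (K : ℕ) :
    ∀ y : ℝ, y ≤ 4 ^ K → y * (ω - θ) ^ 2 ≤ 1 → y ≤ 1 + ∑ k ∈ Finset.range K,
      (Metric.ball ω ((1 / 2) ^ k)).indicator (fun _ => (4 : ℝ) ^ (k + 1)) θ := by
  have h0 : ∀ k, 0 ≤ (Metric.ball ω ((1 / 2) ^ k)).indicator (fun _ => (4 : ℝ) ^ (k + 1)) θ :=
    fun k => Set.indicator_nonneg (fun _ _ => by positivity) _
  induction K with
  | zero => intro y hy _; simpa using hy
  | succ K ih =>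
    intro y hy hyx
    rw [Finset.sum_range_succ]
    by_cases hθ : θ ∈ Metric.ball ω ((1 / 2) ^ K)
    · rw [Set.indicator_of_mem hθ]
      have := Finset.sum_nonneg fun k (_ : k ∈ Finset.range K) => h0 k
      linarith
    · have h1 : ((1 : ℝ) / 2) ^ K ≤ |ω - θ| := by
        rwa [Metric.mem_ball', Real.dist_eq, not_lt] at hθ
      have h2 : ((1 : ℝ) / 4) ^ K ≤ (ω - θ) ^ 2 := by
        calc ((1 : ℝ) / 4) ^ K = ((1 / 2) ^ K) ^ 2 := by rw [← pow_mul, mul_comm, pow_mul]; norm_num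
          _ ≤ |ω - θ| ^ 2 := by gcongr
          _ = (ω - θ) ^ 2 := sq_abs _
      have h3 : y ≤ 4 ^ K := by
        rcases le_or_gt y 0 with hy0 | hy0
        · exact hy0.trans (by positivity)
        have h4 : y * (1 / 4) ^ K ≤ 1 := le_trans (by gcongr) hyx
        rwa [one_div, inv_pow, ← div_eq_mul_inv, div_le_one (by positivity)] at h4
      linarith [ih y h3 hyx, h0 K]

/-- If balls around `ω` of radius `r` have mass at most `r ^ γ` with `γ < 2`, then the Fejér means
at scale `L` are `O(L ^ (2 - γ))`: the kernel is dominated by a sum over dyadic balls. -/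
lemma exists_integral_fejer_le {σ : Measure ℝ} [IsFiniteMeasure σ] {ω γ : ℝ} (hγ : γ < 2)
    (h : ∀ᶠ r : ℝ in 𝓝[>] 0, σ (Metric.ball ω r) ≤ ENNReal.ofReal (r ^ γ)) :
    ∃ C : ℝ, ∀ K : ℕ, ∫ θ, fejer (2 ^ K) (ω - θ) ∂σ ≤ C * ((2 : ℝ) ^ K) ^ (2 - γ) := by
  set ρ : ℝ := 2 ^ (2 - γ) with hρ
  have hρ1 : 1 < ρ := Real.one_lt_rpow one_lt_two (by linarith)
  have hpow : ∀ K : ℕ, ((2 : ℝ) ^ K) ^ (2 - γ) = ρ ^ K := by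
    intro K
    rw [hρ, ← Real.rpow_natCast, ← Real.rpow_mul zero_le_two, mul_comm, Real.rpow_mul zero_le_two,
      Real.rpow_natCast]
  have hterm : ∀ k : ℕ, (4 : ℝ) ^ (k + 1) * ((1 / 2) ^ k : ℝ) ^ γ = 4 * ρ ^ k := by
    intro k
    rw [← hpow, Real.rpow_sub (by positivity), one_div, inv_pow, Real.inv_rpow (by positivity),
      pow_succ]
    have : ((2 : ℝ) ^ k) ^ (2 : ℝ) = 4 ^ k := by
      rw [Real.rpow_two, ← pow_mul, mul_comm, pow_mul]; norm_num
    rw [this]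
    ring
  have hhalf : Tendsto (fun k : ℕ => ((1 : ℝ) / 2) ^ k) atTop (𝓝[>] 0) :=
    tendsto_nhdsWithin_iff.mpr ⟨tendsto_pow_atTop_nhds_zero_of_lt_one (by norm_num) (by norm_num),
      Eventually.of_forall fun k => by simp⟩
  obtain ⟨C, hC⟩ : BddAbove (Set.range fun k : ℕ =>
      σ.real (Metric.ball ω ((1 / 2) ^ k)) / ((1 / 2) ^ k : ℝ) ^ γ) := by
    refine IsBoundedUnder.bddAbove_range ⟨1, ?_⟩
    rw [eventually_map]
    filter_upwards [hhalf.eventually h] with k hk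
    have hpos : 0 < ((1 / 2 : ℝ) ^ k) ^ γ := by positivity
    rw [div_le_one hpos, measureReal_def]
    exact ENNReal.toReal_le_of_le_ofReal hpos.le hk
  have hC' : ∀ k : ℕ, σ.real (Metric.ball ω ((1 / 2) ^ k)) ≤ C * ((1 / 2) ^ k : ℝ) ^ γ := by
    intro k
    have := hC ⟨k, rfl⟩
    rwa [div_le_iff₀ (by positivity)] at this
  have hC0 : 0 ≤ C := le_trans (by positivity) (hC ⟨0, rfl⟩)
  refine ⟨σ.real Set.univ + 4 * C / (ρ - 1), fun K => ?_⟩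
  have hI : ∀ k : ℕ, Integrable
      ((Metric.ball ω ((1 / 2) ^ k)).indicator (fun _ => (4 : ℝ) ^ (k + 1))) σ :=
    fun k => (integrable_const _).indicator measurableSet_ball
  calc ∫ θ, fejer (2 ^ K) (ω - θ) ∂σ
      ≤ ∫ θ, (1 + ∑ k ∈ Finset.range K,
        (Metric.ball ω ((1 / 2) ^ k)).indicator (fun _ => (4 : ℝ) ^ (k + 1)) θ) ∂σ := by
        refine integral_mono (integrable_fejer σ (by positivity) ω)
          ((integrable_const _).add (integrable_finsetSum _ fun k _ => hI k)) fun θ => ?_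
        refine le_one_add_sum_indicator ω θ K _ ?_ (fejer_mul_sq_le _ _)
        refine (fejer_le_sq (by positivity) _).trans (le_of_eq ?_)
        rw [← pow_mul, mul_comm, pow_mul]
        norm_num
    _ = σ.real Set.univ + ∑ k ∈ Finset.range K,
        σ.real (Metric.ball ω ((1 / 2) ^ k)) * 4 ^ (k + 1) := by
        rw [integral_add (integrable_const _) (integrable_finsetSum _ fun k _ => hI k),
          integral_finsetSum _ fun k _ => hI k]
        simp [integral_indicator_const _ measurableSet_ball]
    _ ≤ σ.real Set.univ + ∑ k ∈ Finset.range K, 4 * C * ρ ^ k := by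
        refine add_le_add le_rfl (Finset.sum_le_sum fun k _ => ?_)
        calc _ ≤ C * ((1 / 2) ^ k : ℝ) ^ γ * 4 ^ (k + 1) := by gcongr; exact hC' k
          _ = 4 * C * ρ ^ k := by rw [mul_assoc, mul_comm (_ ^ γ), hterm]; ring
    _ ≤ (σ.real Set.univ + 4 * C / (ρ - 1)) * ((2 : ℝ) ^ K) ^ (2 - γ) := by
        rw [hpow, ← Finset.mul_sum, geom_sum_eq hρ1.ne', add_mul, ← mul_div_assoc]
        have h1 : 1 ≤ ρ ^ K := one_le_pow₀ hρ1.le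
        have h2 : 0 < ρ - 1 := by linarith
        refine add_le_add (le_mul_of_one_le_right measureReal_nonneg h1) ?_
        rw [div_mul_eq_mul_div]
        gcongr
        linarith

/-! ### Twisted integrals along tilings -/

lemma stronglyMeasurable_twisted {s : Fin m → ℝ} (hs : ∀ j, 0 < s j) (b : Fin m → ℂ) (ω : ℝ)
    (x : ℤ → Fin m) : StronglyMeasurable fun r => tilingFun s b x r * phase (ω * r) := by
  refine Measurable.stronglyMeasurable (Measurable.mul ?_ ?_)
  · exact (measurable_tilingFun hs b).comp measurable_prodMk_left
  · exact (continuous_phase.comp (by fun_prop)).measurable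

lemma intervalIntegrable_twisted {s : Fin m → ℝ} (hs : ∀ j, 0 < s j) (b : Fin m → ℂ) (ω : ℝ)
    (x : ℤ → Fin m) (u v : ℝ) :
    IntervalIntegrable (fun r => tilingFun s b x r * phase (ω * r)) volume u v := by
  obtain ⟨B, hB0, hB⟩ := exists_norm_tilingFun_le s b
  refine intervalIntegrable_of_norm_le (stronglyMeasurable_twisted hs b ω x) (C := B)
    (fun r => ?_) u v
  rw [norm_mul, norm_phase, mul_one]
  exact hB _ _

lemma norm_integral_translate (s : Fin m → ℝ) (b : Fin m → ℂ) (ω : ℝ) (x : ℤ → Fin m)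
    (t L : ℝ) : ‖∫ τ in (0 : ℝ)..L, tilingFun s b x (t + τ) * phase (ω * τ)‖ =
      ‖∫ r in t..t + L, tilingFun s b x r * phase (ω * r)‖ := by
  have h1 : ∀ τ, tilingFun s b x (t + τ) * phase (ω * τ) =
      phase (-(ω * t)) * (tilingFun s b x (t + τ) * phase (ω * (t + τ))) := by
    intro τ
    rw [show ω * τ = -(ω * t) + ω * (t + τ) by ring, phase_add]
    ring_nf
  simp only [h1]
  rw [intervalIntegral.integral_const_mul, norm_mul, norm_phase, one_mul,
    intervalIntegral.integral_comp_add_left (fun r => tilingFun s b x r * phase (ω * r)), add_zero]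

lemma integral_tile {s : Fin m → ℝ} (hs : ∀ j, 0 < s j) (b : Fin m → ℂ) {ω : ℝ} (hω : ω ≠ 0)
    (x : ℤ → Fin m) (n : ℤ) :
    ∫ r in cocycleSum s x n..cocycleSum s x (n + 1), tilingFun s b x r * phase (ω * r) =
      phase (ω * cocycleSum s x n) * Gam s ω b (x n) := by
  have hle : cocycleSum s x n ≤ cocycleSum s x (n + 1) :=
    (cocycleSum_strictMono hs x (lt_add_one n)).le
  have h1 : ∫ r in cocycleSum s x n..cocycleSum s x (n + 1),
      tilingFun s b x r * phase (ω * r) =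
      ∫ r in cocycleSum s x n..cocycleSum s x (n + 1), b (x n) * phase (ω * r) := by
    rw [intervalIntegral.integral_of_le hle, intervalIntegral.integral_of_le hle,
      ← integral_Ico_eq_integral_Ioc, ← integral_Ico_eq_integral_Ioc]
    refine setIntegral_congr_fun measurableSet_Ico fun r hr => ?_
    simp only [tilingFun_of_mem hs b hr.1 hr.2]
  have h2 : phase (ω * s (x n)) =
      Complex.exp (-2 * Real.pi * Complex.I * ω * s (x n)) := by
    rw [phase_mul_eq_exp]
  rw [h1, intervalIntegral.integral_const_mul, integral_phase hω, cocycleSum_succ, mul_add,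
    phase_add, Gam, if_neg hω, ← h2]
  ring

/-- The twisted integral over a patch of tiles is the exponential sum over the word it spells. -/
lemma integral_patch {s : Fin m → ℝ} (hs : ∀ j, 0 < s j) (b : Fin m → ℂ) {ω : ℝ} (hω : ω ≠ 0)
    (x : ℤ → Fin m) (L : ℕ) (i : ℤ) :
    ∫ r in cocycleSum s x i..cocycleSum s x (i + L), tilingFun s b x r * phase (ω * r) =
      phase (ω * cocycleSum s x i) * wordSum (ω • s) (Gam s ω b) (factor x i L) := by
  induction L generalizing i with
  | zero => simp [factor, wordSum]
  | succ L ih =>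
    have hf : factor x i (L + 1) = x i :: factor x (i + 1) L := by
      unfold factor
      rw [List.ofFn_succ]
      congr 1
      · simp
      · congr 1
        funext k
        simp only [Fin.val_succ]
        congr 1
        push_cast
        ring
    rw [← intervalIntegral.integral_add_adjacent_intervals
      (intervalIntegrable_twisted hs b ω x _ (cocycleSum s x (i + 1)))
      (intervalIntegrable_twisted hs b ω x _ _), integral_tile hs b hω, hf, wordSum,
      show i + ((L + 1 : ℕ) : ℤ) = i + 1 + L by push_cast; ring, ih (i + 1), cocycleSum_succ,
      mul_add, phase_add, Pi.smul_apply, smul_eq_mul]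
    ring

/-- A bound for exponential sums over words turns into a bound for the twisted integrals over
arbitrary intervals, since at most two incomplete tiles remain. -/
lemma exists_norm_integral_twisted_le {s : Fin m → ℝ} [Nonempty (Fin m)] (hs : ∀ j, 0 < s j)
    (b : Fin m → ℂ)
    {ω : ℝ} (hω : ω ≠ 0) {X : Set (ℤ → Fin m)} {C β : ℝ} (hβ : 0 ≤ β) (hC0 : 0 ≤ C)
    (hC : ∀ x ∈ X, ∀ (i : ℤ) (L : ℕ),
      ‖wordSum (ω • s) (Gam s ω b) (factor x i L)‖ ≤ C * (L : ℝ) ^ β) :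
    ∃ C' : ℝ, 0 ≤ C' ∧ ∀ x ∈ X, ∀ u v : ℝ, 0 ≤ v →
      ‖∫ r in u..u + v, tilingFun s b x r * phase (ω * r)‖ ≤ C' * (1 + v) ^ β := by
  obtain ⟨B, hB0, hB⟩ := exists_norm_tilingFun_le s b
  obtain ⟨S, hS⟩ := Finite.exists_le s
  obtain ⟨j₀, hj₀⟩ := Finite.exists_min s
  have hS0 : 0 < S := (hs j₀).trans_le (hS j₀)
  set κ := (1 + S) / s j₀ with hκ
  have hsj := hs j₀
  have hκ0 : 0 ≤ κ := by positivity
  refine ⟨C * κ ^ β + 2 * (B * S), by positivity, fun x hx u v hv => ?_⟩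
  set h : ℝ → ℂ := fun r => tilingFun s b x r * phase (ω * r) with hh
  have hi := intervalIntegrable_twisted hs b ω x
  obtain ⟨p1, p2⟩ := tileIndex_spec hs x u
  obtain ⟨q1, q2⟩ := tileIndex_spec hs x (u + v)
  set n₁ := tileIndex s x u
  set n₂ := tileIndex s x (u + v)
  rw [cocycleSum_succ] at p2
  have q2' := q2
  rw [cocycleSum_succ] at q2'
  have hn : n₁ ≤ n₂ := by
    have := (cocycleSum_strictMono hs x).lt_iff_lt.mp
      (p1.trans_lt ((le_add_of_nonneg_right hv).trans_lt q2))
    omega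
  obtain ⟨L, hL⟩ := Int.eq_ofNat_of_zero_le (sub_nonneg.mpr hn)
  have hn₂ : n₂ = n₁ + L := by omega
  have hshort : ∀ c d : ℝ, c ≤ d → d ≤ c + S → ‖∫ r in c..d, h r‖ ≤ B * S := by
    intro c d h1 h2
    refine (intervalIntegral.norm_integral_le_of_norm_le_const (C := B) fun r _ => ?_).trans ?_
    · rw [hh, norm_mul, norm_phase, mul_one]
      exact hB _ _
    · rw [abs_of_nonneg (by linarith)]
      gcongr
      linarith
  have hsplit : ∫ r in u..u + v, h r = (∫ r in cocycleSum s x n₁..cocycleSum s x n₂, h r) +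
      (∫ r in cocycleSum s x n₂..u + v, h r) - ∫ r in cocycleSum s x n₁..u, h r := by
    rw [intervalIntegral.integral_add_adjacent_intervals (hi _ _) (hi _ _),
      intervalIntegral.integral_interval_sub_left (hi _ _) (hi _ _)]
  have hlen : ∀ k : ℕ, cocycleSum s x n₁ + k * s j₀ ≤ cocycleSum s x (n₁ + k) := by
    intro k
    induction k with
    | zero => simp
    | succ k ih =>
      push_cast
      rw [← add_assoc, cocycleSum_succ]
      linarith [hj₀ (x (n₁ + k))]
  have hLv : (L : ℝ) ≤ κ * (1 + v) := by
    have h1 := hlen L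
    rw [← hn₂] at h1
    rw [hκ, div_mul_eq_mul_div, le_div_iff₀ hsj]
    nlinarith [hS (x n₁)]
  have hmain : ‖∫ r in cocycleSum s x n₁..cocycleSum s x n₂, h r‖ ≤
      C * κ ^ β * (1 + v) ^ β := by
    rw [hn₂, integral_patch hs b hω, norm_mul, norm_phase, one_mul, mul_assoc,
      ← Real.mul_rpow hκ0 (by linarith)]
    refine (hC x hx _ _).trans ?_
    gcongr
  have h1 := hshort _ _ q1 (by linarith [hS (x n₂)])
  have h2 := hshort _ _ p1 (by linarith [hS (x n₁)])
  have h3 : 1 ≤ (1 + v) ^ β := Real.one_le_rpow (by linarith) hβ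
  have hBS : 0 ≤ B * S := by positivity
  rw [hsplit]
  refine (norm_sub_le _ _).trans ?_
  have h4 := norm_add_le (∫ r in cocycleSum s x n₁..cocycleSum s x n₂, h r)
    (∫ r in cocycleSum s x n₂..u + v, h r)
  nlinarith

/-- The integral of `h` over `[u, u + ℓ]` is the average over the starting point of integrals over
intervals of length `L`, up to boundary terms that involve only intervals of length at most `L`. -/
lemma mul_norm_integral_le {h : ℝ → ℂ} (hi : ∀ u v, IntervalIntegrable h volume u v)
    {L E : ℝ} (hL : 0 ≤ L) (hE : ∀ u v, 0 ≤ v → v ≤ L → ‖∫ r in u..u + v, h r‖ ≤ E) (u ℓ : ℝ) :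
    L * ‖∫ r in u..u + ℓ, h r‖ ≤
      ‖∫ t in u..u + ℓ, ∫ r in t..t + L, h r‖ + 2 * (L * E) := by
  set H : ℝ → ℂ := fun t => ∫ r in (0 : ℝ)..t, h r with hH
  have hHc : Continuous H := intervalIntegral.continuous_primitive hi 0
  have hHi : ∀ c d, IntervalIntegrable H volume c d := fun c d => hHc.intervalIntegrable c d
  have hHl : ∀ e c d, IntervalIntegrable (fun t => H (e + t)) volume c d := fun e c d =>
    (hHc.comp (by fun_prop : Continuous fun t : ℝ => e + t)).intervalIntegrable c d
  have hHr : ∀ e c d, IntervalIntegrable (fun t => H (t + e)) volume c d := fun e c d =>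
    (hHc.comp (by fun_prop : Continuous fun t : ℝ => t + e)).intervalIntegrable c d
  have hdiff : ∀ c d, ∫ r in c..d, h r = H d - H c := fun c d =>
    (intervalIntegral.integral_interval_sub_left (hi _ _) (hi _ _)).symm
  have h1 : ∫ t in u..u + ℓ, ∫ r in t..t + L, h r =
      (∫ v in (0 : ℝ)..L, H (u + ℓ + v)) - ∫ v in (0 : ℝ)..L, H (u + v) := by
    simp only [hdiff]
    rw [intervalIntegral.integral_sub (hHr _ _ _) (hHi _ _),
      intervalIntegral.integral_comp_add_right, intervalIntegral.integral_comp_add_left,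
      intervalIntegral.integral_comp_add_left, add_zero, add_zero]
    rw [← intervalIntegral.integral_interval_sub_left (hHi 0 (u + ℓ + L)) (hHi 0 (u + L)),
      ← intervalIntegral.integral_interval_sub_left (hHi 0 (u + ℓ)) (hHi 0 u),
      ← intervalIntegral.integral_interval_sub_left (hHi 0 (u + ℓ + L)) (hHi 0 (u + ℓ)),
      ← intervalIntegral.integral_interval_sub_left (hHi 0 (u + L)) (hHi 0 u)]
    ring
  have h2 : (L : ℂ) * ∫ r in u..u + ℓ, h r = (∫ t in u..u + ℓ, ∫ r in t..t + L, h r) -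
      ((∫ v in (0 : ℝ)..L, ∫ r in u + ℓ..u + ℓ + v, h r) -
        ∫ v in (0 : ℝ)..L, ∫ r in u..u + v, h r) := by
    rw [h1]
    simp only [hdiff]
    rw [intervalIntegral.integral_sub (hHl _ _ _) intervalIntegrable_const,
      intervalIntegral.integral_sub (hHl _ _ _) intervalIntegrable_const]
    simp only [intervalIntegral.integral_const, sub_zero, Complex.real_smul]
    ring
  have h3 : ∀ w, ‖∫ v in (0 : ℝ)..L, ∫ r in w..w + v, h r‖ ≤ L * E := by
    intro w
    refine (intervalIntegral.norm_integral_le_of_norm_le_const (C := E) fun v hv => ?_).trans ?_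
    · rw [Set.uIoc_of_le hL] at hv
      exact hE w v hv.1.le hv.2
    · rw [sub_zero, abs_of_nonneg hL, mul_comm]
  have h4 := congrArg norm h2
  rw [norm_mul, Complex.norm_real, Real.norm_of_nonneg hL] at h4
  rw [h4]
  refine (norm_sub_le _ _).trans ?_
  have h5 := norm_sub_le (∫ v in (0 : ℝ)..L, ∫ r in u + ℓ..u + ℓ + v, h r)
    (∫ v in (0 : ℝ)..L, ∫ r in u..u + v, h r)
  linarith [h3 (u + ℓ), h3 u]

lemma sq_norm_integral_le {J : ℝ → ℂ} (hJ : Continuous J) (u : ℝ) {ℓ : ℝ} (hℓ : 0 < ℓ) :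
    ‖∫ t in u..u + ℓ, J t‖ ^ 2 ≤ ℓ * ∫ t in u..u + ℓ, ‖J t‖ ^ 2 := by
  have h1 : ‖∫ t in u..u + ℓ, J t‖ ≤ ∫ t in u..u + ℓ, ‖J t‖ :=
    intervalIntegral.norm_integral_le_integral_norm (by linarith)
  set M := ∫ t in u..u + ℓ, ‖J t‖ with hM
  -- Integrate `2 c ‖J‖ - c² ≤ ‖J‖²` with the mean value `c = M / ℓ`.
  have h2 : ∫ t in u..u + ℓ, (2 * (M / ℓ) * ‖J t‖ - (M / ℓ) ^ 2) ≤
      ∫ t in u..u + ℓ, ‖J t‖ ^ 2 := by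
    refine intervalIntegral.integral_mono_on (by linarith)
      (Continuous.intervalIntegrable (by fun_prop) _ _)
      (Continuous.intervalIntegrable (by fun_prop) _ _) fun t _ => ?_
    nlinarith [sq_nonneg (‖J t‖ - M / ℓ)]
  rw [intervalIntegral.integral_sub (Continuous.intervalIntegrable (by fun_prop) _ _) (by simp),
    intervalIntegral.integral_const_mul, ← hM, intervalIntegral.integral_const,
    add_sub_cancel_left, smul_eq_mul] at h2
  have h3 : 2 * (M / ℓ) * M - ℓ * (M / ℓ) ^ 2 = M ^ 2 / ℓ := by field_simp; ring
  rw [h3, div_le_iff₀ hℓ] at h2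
  have h4 : ‖∫ t in u..u + ℓ, J t‖ ^ 2 ≤ M ^ 2 := by gcongr
  linarith

/-- The function `(x, t) ↦ |∫₀^L g_x(t + τ) exp (-2πi ω τ) dτ|²` whose mean is `meanSq`. -/
def twistSq (s : Fin m → ℝ) (b : Fin m → ℂ) (ω L : ℝ) (x : ℤ → Fin m) (t : ℝ) : ℝ :=
  ‖∫ τ in (0 : ℝ)..L, tilingFun s b x (t + τ) * phase (ω * τ)‖ ^ 2

lemma stronglyMeasurable_twistSq {s : Fin m → ℝ} (hs : ∀ j, 0 < s j) (b : Fin m → ℂ) (ω : ℝ)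
    (L : ℝ) : StronglyMeasurable (Function.uncurry (twistSq s b ω L)) := by
  have e : Measurable fun q : ((ℤ → Fin m) × ℝ) × ℝ => (q.1.1, q.1.2 + q.2) := by fun_prop
  have e2 : Measurable fun q : ((ℤ → Fin m) × ℝ) × ℝ => ω * q.2 := by fun_prop
  have hF : StronglyMeasurable (Function.uncurry fun (p : (ℤ → Fin m) × ℝ) (τ : ℝ) =>
      tilingFun s b p.1 (p.2 + τ) * phase (ω * τ)) :=
    (((measurable_tilingFun hs b).comp e).mul
      (continuous_phase.measurable.comp e2)).stronglyMeasurable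
  exact (stronglyMeasurable_intervalIntegral hF (measurable_const (a := L))).norm.pow 2

lemma exists_twistSq_le (s : Fin m → ℝ) (b : Fin m → ℂ) (ω L : ℝ) :
    ∃ C, ∀ x t, ‖twistSq s b ω L x t‖ ≤ C := by
  obtain ⟨B, hB0, hB⟩ := exists_norm_tilingFun_le s b
  refine ⟨(B * |L - 0|) ^ 2, fun x t => ?_⟩
  rw [twistSq, Real.norm_of_nonneg (sq_nonneg _)]
  gcongr
  refine intervalIntegral.norm_integral_le_of_norm_le_const fun τ _ => ?_
  rw [norm_mul, norm_phase, mul_one]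
  exact hB _ _

lemma meanSq_le {a : ℕ → Substitution m} {s : Fin m → ℝ} {μ : Measure (ℤ → Fin m)}
    [IsProbabilityMeasure μ] (hμX : ∀ᵐ x ∂μ, x ∈ space a) (hs : ∀ j, 0 < s j) {S : ℝ}
    (hS : ∀ j, s j ≤ S) (b : Fin m → ℂ) {ω L E : ℝ}
    (hE : ∀ x ∈ space a, ∀ u, ‖∫ r in u..u + L, tilingFun s b x r * phase (ω * r)‖ ≤ E) :
    meanSq s μ b ω L ≤ S * E ^ 2 := by
  have h : ∀ᵐ x ∂μ, ‖∫ t in (0 : ℝ)..s (x 0), twistSq s b ω L x t‖ ≤ S * E ^ 2 := by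
    filter_upwards [hμX] with x hx
    refine (intervalIntegral.norm_integral_le_of_norm_le_const (C := E ^ 2) fun t _ => ?_).trans ?_
    · rw [twistSq, Real.norm_of_nonneg (sq_nonneg _), norm_integral_translate]
      gcongr
      exact hE x hx t
    · rw [sub_zero, abs_of_pos (hs _), mul_comm]
      gcongr
      exact hS _
  have h2 := norm_integral_le_of_norm_le_const h
  rw [probReal_univ, mul_one] at h2
  exact (le_abs_self _).trans h2

/-- Lower bound for the mean square: if a word `w` with large exponential sum occurs in every window
of `W` tiles, while twisted integrals over intervals of length at most `L` are small, then the
average over the patch `w` of the squared twisted integrals of length `L` is large. -/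
lemma le_meanSq {a : ℕ → Substitution m} {s : Fin m → ℝ} {μ : Measure (ℤ → Fin m)}
    [IsProbabilityMeasure μ] (hμX : ∀ᵐ x ∂μ, x ∈ space a)
    (hμT : MeasurePreserving (shift 1) μ μ) (hs : ∀ j, 0 < s j) {S : ℝ} (hS : ∀ j, s j ≤ S)
    (b : Fin m → ℂ) {ω L E : ℝ} (hω : ω ≠ 0) (hL : 0 ≤ L)
    (hE : ∀ x ∈ space a, ∀ u v, 0 ≤ v → v ≤ L →
      ‖∫ r in u..u + v, tilingFun s b x r * phase (ω * r)‖ ≤ E)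
    {w : List (Fin m)} (hw : w ≠ []) {W : ℕ}
    (hW : ∀ x ∈ space a, ∃ p : ℕ, p + w.length ≤ W ∧ factor x p w.length = w)
    (hwE : 4 * E ≤ ‖wordSum (ω • s) (Gam s ω b) w‖) :
    L ^ 2 * ‖wordSum (ω • s) (Gam s ω b) w‖ ^ 2 ≤ 4 * S * W ^ 2 * meanSq s μ b ω L := by
  set A := ‖wordSum (ω • s) (Gam s ω b) w‖ with hA
  have hm := stronglyMeasurable_twistSq hs b ω L
  obtain ⟨C, hC⟩ := exists_twistSq_le s b ω L
  have hpt : ∀ x ∈ space a, L ^ 2 * A ^ 2 ≤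
      4 * S * W * ∫ t in (0 : ℝ)..cocycleSum s x W, twistSq s b ω L x t := by
    intro x hx
    obtain ⟨p, hp1, hp2⟩ := hW x hx
    have hmono := cocycleSum_strictMono hs x
    set u := cocycleSum s x p with hu
    set ℓ := cocycleSum s x (p + w.length) - u with hℓ
    have hwl : 0 < w.length := List.length_pos_iff.mpr hw
    have hℓ0 : 0 < ℓ := sub_pos.mpr (hmono (by omega))
    have hu0 : 0 ≤ u := by
      rw [← cocycleSum_zero s x]
      exact hmono.monotone (by omega)
    have huℓ : u + ℓ = cocycleSum s x (p + w.length) := by rw [hℓ]; ring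
    have hend : u + ℓ ≤ cocycleSum s x W := by
      rw [huℓ]
      exact hmono.monotone (by omega)
    have hℓW : ℓ ≤ S * W := by
      have h1 : ∀ k : ℕ, cocycleSum s x (p + k) ≤ u + k * S := by
        intro k
        induction k with
        | zero => simp [hu]
        | succ k ih =>
          push_cast
          rw [← add_assoc, cocycleSum_succ]
          linarith [hS (x (p + k))]
      have h2 := h1 w.length
      have h3 : (w.length : ℝ) * S ≤ W * S := by
        have hS0 : 0 ≤ S := (hs (x 0)).le.trans (hS _)
        gcongr
        omega
      linarith
    have hi := intervalIntegrable_twisted hs b ω x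
    set h : ℝ → ℂ := fun r => tilingFun s b x r * phase (ω * r) with hh
    set J : ℝ → ℂ := fun t => ∫ r in t..t + L, h r with hJ
    have hJc : Continuous J := by
      have hHc : Continuous fun t => ∫ r in (0 : ℝ)..t, h r :=
        intervalIntegral.continuous_primitive hi 0
      have : J = fun t => (∫ r in (0 : ℝ)..t + L, h r) - ∫ r in (0 : ℝ)..t, h r := by
        ext t
        exact (intervalIntegral.integral_interval_sub_left (hi _ _) (hi _ _)).symm
      rw [this]
      exact (hHc.comp (by fun_prop : Continuous fun t : ℝ => t + L)).sub hHc
    have h1 := mul_norm_integral_le hi hL (hE x hx) u ℓ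
    have hAeq : ‖∫ r in u..u + ℓ, h r‖ = A := by
      rw [huℓ, hu, integral_patch hs b hω, hp2, norm_mul, norm_phase, one_mul]
    rw [hAeq] at h1
    have h2 : L * A / 2 ≤ ‖∫ t in u..u + ℓ, J t‖ := by nlinarith
    have h3 := sq_norm_integral_le hJc u hℓ0
    have h4 : ∫ t in u..u + ℓ, ‖J t‖ ^ 2 ≤
        ∫ t in (0 : ℝ)..cocycleSum s x W, twistSq s b ω L x t := by
      have h5 : ∀ t, twistSq s b ω L x t = ‖J t‖ ^ 2 := fun t => by
        rw [twistSq, norm_integral_translate]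
      simp only [h5]
      exact intervalIntegral.integral_mono_interval hu0 (by linarith) hend
        (Eventually.of_forall fun t => sq_nonneg _)
        (Continuous.intervalIntegrable (by fun_prop) _ _)
    have h5 : (L * A / 2) ^ 2 ≤ ‖∫ t in u..u + ℓ, J t‖ ^ 2 := by
      have : 0 ≤ A := norm_nonneg _
      gcongr
    have h6 : 0 ≤ ∫ t in u..u + ℓ, ‖J t‖ ^ 2 :=
      intervalIntegral.integral_nonneg (by linarith) fun t _ => sq_nonneg _
    have h7 : ℓ * ∫ t in u..u + ℓ, ‖J t‖ ^ 2 ≤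
        S * W * ∫ t in (0 : ℝ)..cocycleSum s x W, twistSq s b ω L x t :=
      mul_le_mul hℓW h4 h6 (hℓ0.le.trans hℓW)
    nlinarith
  have hav := integral_cocycleSum hμT hm hC (s := s) (fun x r => by
    simp only [twistSq, tilingFun_shift_one hs]
    congr 2
    refine intervalIntegral.integral_congr fun τ _ => ?_
    congr 2
    ring) W
  obtain ⟨S', hS'⟩ := Finite.exists_le fun j => |s j|
  have hint : Integrable (fun x => ∫ t in (0 : ℝ)..cocycleSum s x W, twistSq s b ω L x t) μ := by
    have hb : ∀ (n : ℕ) (x : ℤ → Fin m), |cocycleSum s x n| ≤ n * S' := by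
      intro n x
      induction n with
      | zero => simp [cocycleSum_zero]
      | succ n ih =>
        push_cast
        rw [cocycleSum_succ]
        refine (abs_add_le _ _).trans ?_
        linarith [hS' (x n)]
    exact integrable_intervalIntegral hm hC (measurable_cocycleSum s W) (hb W)
  have h1 : ∫ _x, L ^ 2 * A ^ 2 ∂μ ≤
      ∫ x, 4 * S * W * (∫ t in (0 : ℝ)..cocycleSum s x W, twistSq s b ω L x t) ∂μ :=
    integral_mono_ae (integrable_const _) (hint.const_mul _) (hμX.mono fun x hx => hpt x hx)
  rw [integral_const, probReal_univ, one_smul, integral_const_mul, hav, nsmul_eq_mul] at h1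
  calc L ^ 2 * A ^ 2 ≤ _ := h1
    _ = 4 * S * W ^ 2 * meanSq s μ b ω L := by
      rw [meanSq]
      simp only [twistSq]
      ring

/-! ### The local dimension of the spectral measure -/

lemma eventually_const_mul_exp_lt (M : ℝ) {c d : ℝ} (h : c < d) :
    ∀ᶠ n : ℕ in atTop, M * Real.exp (c * n) < Real.exp (d * n) := by
  have h1 : Tendsto (fun n : ℕ => Real.exp ((d - c) * n)) atTop atTop :=
    Real.tendsto_exp_atTop.comp
      (tendsto_natCast_atTop_atTop.const_mul_atTop (sub_pos.mpr h))
  filter_upwards [h1.eventually_gt_atTop M] with n hn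
  calc M * Real.exp (c * n) < Real.exp ((d - c) * n) * Real.exp (c * n) := by gcongr
    _ = Real.exp (d * n) := by rw [← Real.exp_add]; ring_nf

lemma le_lowerDim_of_integral_fejer_le {σ : Measure ℝ} [IsFiniteMeasure σ] {ω C β γ : ℝ}
    (hγ : γ < 2 - 2 * β)
    (h : ∀ L : ℝ, 1 ≤ L → ∫ θ, fejer L (ω - θ) ∂σ ≤ C * L ^ (2 * β)) :
    (γ : EReal) ≤ lowerDim σ ω := by
  refine le_lowerDim_of_eventually_le ?_
  have h1 : ∀ᶠ r : ℝ in 𝓝[>] 0, r ∈ Set.Ioo (0 : ℝ) (1 / 8) := Ioo_mem_nhdsGT (by norm_num)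
  have h2 : Tendsto (fun r : ℝ => 4 * C * 8 ^ (2 - 2 * β) * r ^ (2 - 2 * β - γ)) (𝓝[>] 0)
      (𝓝 0) := by
    have h3 : ContinuousAt (fun r : ℝ => r ^ (2 - 2 * β - γ)) 0 :=
      Real.continuousAt_rpow_const _ _ (Or.inr (by linarith))
    have h4 := (h3.tendsto.mono_left (nhdsWithin_le_nhds (s := Set.Ioi 0))).const_mul
      (4 * C * 8 ^ (2 - 2 * β))
    rwa [Real.zero_rpow (by linarith), mul_zero] at h4
  filter_upwards [h1, h2.eventually (gt_mem_nhds one_pos)] with r ⟨hr0, hr1⟩ hr2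
  have hL : 1 ≤ 1 / (8 * r) := by rw [le_div_iff₀ (by positivity)]; linarith
  have h3 := (measureReal_ball_mul_le σ (by linarith : 0 < 1 / (8 * r)) ω).trans (h _ hL)
  rw [show 1 / (8 * (1 / (8 * r))) = r by field_simp] at h3
  have h5 : (1 / (8 * r)) ^ (2 * β) = (8 ^ (2 - 2 * β) * r ^ (2 - 2 * β)) * (1 / (8 * r)) ^ 2 := by
    rw [← Real.mul_rpow (by norm_num) hr0.le, one_div, Real.inv_rpow (by positivity),
      Real.rpow_sub (by positivity), Real.rpow_two]
    field_simp
  rw [h5] at h3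
  have h6 : 0 < (1 / (8 * r)) ^ 2 := by positivity
  have h7 : σ.real (Metric.ball ω r) ≤ 4 * C * 8 ^ (2 - 2 * β) * r ^ (2 - 2 * β) := by
    refine le_of_mul_le_mul_right ?_ h6
    linarith
  have h8 : r ^ (2 - 2 * β) = r ^ (2 - 2 * β - γ) * r ^ γ := by
    rw [← Real.rpow_add hr0]; ring_nf
  have h9 : σ.real (Metric.ball ω r) ≤ r ^ γ := by
    refine h7.trans ?_
    rw [h8, ← mul_assoc]
    exact mul_le_of_le_one_left (by positivity) hr2.le
  rw [ENNReal.le_ofReal_iff_toReal_le (measure_ne_top _ _) (by positivity)]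
  exact h9

/-- Lower bounds for the size `A` of a patch and for the scale `L`, combined with an upper bound of
the mean square at scale `L`, bound the exponents involved. -/
lemma exp_le_of_scale_bounds {A L W M S C c d κ γ x : ℝ} (hM : 0 < M) (hS : 0 < S) (hL : 0 < L)
    (hγ : 0 ≤ γ) (hW0 : 0 ≤ W) (hA : Real.exp (c * x) / M ≤ A) (hLx : Real.exp (κ * x) / 2 ≤ L)
    (hup : L ^ 2 * A ^ 2 ≤ 4 * S * W ^ 2 * (C * (L ^ 2 / L ^ γ)))
    (hW : W ≤ Real.exp (d * x)) :
    Real.exp ((κ * γ + 2 * c) * x) ≤ 4 * S * C * (M ^ 2 * 2 ^ γ) * Real.exp (2 * d * x) := by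
  have hLγ : 0 < L ^ γ := by positivity
  have h1 : A ^ 2 * L ^ γ ≤ 4 * S * C * W ^ 2 := by
    have h2 : L ^ 2 * (A ^ 2 * L ^ γ) ≤ L ^ 2 * (4 * S * C * W ^ 2) := by
      have := mul_le_mul_of_nonneg_right hup hLγ.le
      calc _ = L ^ 2 * A ^ 2 * L ^ γ := by ring
        _ ≤ _ := this
        _ = _ := by field_simp
    exact le_of_mul_le_mul_left h2 (by positivity)
  have h2 : (Real.exp (c * x) / M) ^ 2 * (Real.exp (κ * x) / 2) ^ γ ≤ A ^ 2 * L ^ γ := by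
    gcongr
  have h3 : (Real.exp (c * x) / M) ^ 2 * (Real.exp (κ * x) / 2) ^ γ =
      Real.exp ((κ * γ + 2 * c) * x) / (M ^ 2 * 2 ^ γ) := by
    rw [Real.div_rpow (Real.exp_nonneg _) zero_le_two, ← Real.exp_mul, div_pow,
      ← Real.exp_nat_mul, div_mul_div_comm, ← Real.exp_add]
    congr 2
    push_cast
    ring
  have hC0 : 0 ≤ C := by
    have h4 : 0 < Real.exp ((κ * γ + 2 * c) * x) / (M ^ 2 * 2 ^ γ) := by positivity
    rw [← h3] at h4
    have h5 : 0 < 4 * S * C * W ^ 2 := h4.trans_le (h2.trans h1)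
    by_contra! hneg
    have : 4 * S * C * W ^ 2 ≤ 0 :=
      mul_nonpos_of_nonpos_of_nonneg (by nlinarith) (by positivity)
    linarith
  have h4 : 4 * S * C * W ^ 2 ≤ 4 * S * C * Real.exp (2 * d * x) := by
    have : Real.exp (2 * d * x) = Real.exp (d * x) ^ 2 := by
      rw [← Real.exp_nat_mul]; push_cast; ring_nf
    rw [this]
    gcongr
  have h5 := h2.trans (h1.trans h4)
  rw [h3, div_le_iff₀ (by positivity)] at h5
  linarith

section LocalDimension

variable {a : ℕ → Substitution m} {s : Fin m → ℝ} {μ : Measure (ℤ → Fin m)} {lam : ℝ}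

/-- If the exponential sums over words are `O(N ^ β)`, so are the twisted integrals along flow
orbits, and the spectral measure of a ball of radius `r` is `O(r ^ (2 - 2β))`. -/
lemma le_lowerDim [Nonempty (Fin m)] [IsProbabilityMeasure μ]
    (ha : ∀ n, (a n).InClass) (hA1 : CondA1' a) (hlam : 0 < lam) (hA2 : CondA2 a lam)
    (hA3 : CondA3 a) (hs : ∀ j, 0 < s j) (hμX : ∀ᵐ x ∂μ, x ∈ space a)
    (hμT : MeasurePreserving (shift 1) μ μ) {b : Fin m → ℂ} {ω χ : ℝ} (hω : ω ≠ 0)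
    (hχ : 0 < χ) (hz : lyapVec a (ω • s) (Gam s ω b) ≤ χ) {σ : Measure ℝ}
    (hσ : IsSpectralMeasure (flow s) (suspensionMeasure a s μ) (simpleCyl b) σ) :
    ((2 - 2 * χ / lam : ℝ) : EReal) ≤ lowerDim σ ω := by
  refine EReal.ge_of_forall_gt_iff_ge.mp fun γ hγ => ?_
  have hγ' : γ < 2 - 2 * (χ / lam) := by
    have : γ < 2 - 2 * χ / lam := by exact_mod_cast hγ
    rwa [mul_div_assoc] at this
  obtain ⟨β, hβ1, hβ2⟩ := exists_between (show χ / lam < (2 - γ) / 2 by linarith)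
  have hβ0 : 0 < β := lt_trans (by positivity) hβ1
  obtain ⟨C, hC0, hC⟩ := exists_norm_wordSum_factor_le ha hA1 hlam hA2 hA3 hχ hz hβ1
  obtain ⟨C', hC'0, hC'⟩ := exists_norm_integral_twisted_le hs b hω hβ0.le hC0 hC
  obtain ⟨S, hS⟩ := Finite.exists_le s
  have hS0 : 0 ≤ S := (hs (Classical.arbitrary _)).le.trans (hS _)
  have := hσ.1
  refine le_lowerDim_of_integral_fejer_le (C := S * (C' * 2 ^ β) ^ 2) (β := β) (by linarith)
    fun L hL => ?_
  rw [← meanSq_eq_integral_fejer hμX hμT hs b hσ ω (by linarith)]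
  refine (meanSq_le hμX hs hS b (E := C' * 2 ^ β * L ^ β) fun x hx u => ?_).trans (le_of_eq ?_)
  · refine (hC' x hx u L (by linarith)).trans ?_
    rw [mul_assoc, ← Real.mul_rpow zero_le_two (by linarith)]
    gcongr
    linarith
  · rw [mul_pow, ← Real.rpow_natCast (L ^ β) 2, ← Real.rpow_mul (by linarith)]
    push_cast
    rw [mul_comm β 2]
    ring

/-- If the local dimension at `ω` were larger than `2 - 2χ/λ`, the mean squares of the twisted
integrals of length `L` would be `O(L ^ (2 - γ))` for some `γ > 2 - 2χ/λ`. On the other hand, when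
the spectral cocycle is as large as `exp ((χ - ε) n)` at level `n`, the tiles of level `n` force a
much larger mean square at the scale `L ≈ exp (λ (1 - δ) n)`. -/
lemma lowerDim_le [Nonempty (Fin m)] [IsProbabilityMeasure μ]
    (ha : ∀ n, (a n).InClass) (hA1 : CondA1' a) (hlam : 0 < lam) (hA2 : CondA2 a lam)
    (hA3 : CondA3 a) (hs : ∀ j, 0 < s j) (hμX : ∀ᵐ x ∂μ, x ∈ space a)
    (hμT : MeasurePreserving (shift 1) μ μ) {b : Fin m → ℂ} {ω χ : ℝ} (hω : ω ≠ 0)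
    (hχ : 0 < χ) (hz : lyapVec a (ω • s) (Gam s ω b) = χ) {σ : Measure ℝ}
    (hσ : IsSpectralMeasure (flow s) (suspensionMeasure a s μ) (simpleCyl b) σ) :
    lowerDim σ ω ≤ ((2 - 2 * χ / lam : ℝ) : EReal) := by
  by_contra hcon
  have hχlam : χ ≤ lam := by
    have := lyapVec_le hA2 (ω • s) (Gam s ω b)
    rw [hz] at this
    exact_mod_cast this
  set α := χ / lam with hα
  have hα0 : 0 < α := by positivity
  have hα1 : α ≤ 1 := (div_le_one hlam).mpr hχlam
  have hαl : α * lam = χ := div_mul_cancel₀ _ hlam.ne'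
  have hlt : ((2 - 2 * χ / lam : ℝ) : EReal) < min (lowerDim σ ω) ((2 : ℝ) : EReal) := by
    refine lt_min (not_le.mp hcon) ?_
    rw [EReal.coe_lt_coe_iff, mul_div_assoc]
    linarith
  obtain ⟨γ, hγ1, hγ2⟩ := EReal.lt_iff_exists_real_btwn.mp hlt
  have hγα : 2 - 2 * α < γ := by
    have : 2 - 2 * χ / lam < γ := by exact_mod_cast hγ1
    rwa [mul_div_assoc] at this
  have hγlt : γ < 2 := by exact_mod_cast hγ2.trans_le (min_le_right _ _)
  have hγ0 : 0 < γ := by linarith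
  have hfin := hσ.1
  obtain ⟨C₃, hC₃⟩ := exists_integral_fejer_le hγlt
    (eventually_le_of_lt_lowerDim (hγ2.trans_le (min_le_left _ _)))
  -- `gap` measures the assumed excess; `δ` and then `ε` are small with respect to it.
  set gap := lam * (γ - (2 - 2 * α)) with hgap
  have hgap0 : 0 < gap := mul_pos hlam (by linarith)
  obtain ⟨δ, hδ0, hδ1, hδ2⟩ : ∃ δ : ℝ, 0 < δ ∧ δ < 1 ∧ δ * (γ * lam) ≤ gap / 2 := by
    refine ⟨min (1 / 2) (gap / (2 * (γ * lam))), by positivity, ?_, ?_⟩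
    · exact (min_le_left _ _).trans_lt (by norm_num)
    · calc _ ≤ gap / (2 * (γ * lam)) * (γ * lam) := by gcongr; exact min_le_right _ _
        _ = gap / 2 := by field_simp
  set ε := min (gap / 16) (χ * δ / 2) with hε
  have hε0 : 0 < ε := by positivity
  have hε1 : ε ≤ gap / 16 := min_le_left _ _
  have hε2 : ε ≤ χ * δ / 2 := min_le_right _ _
  set β := α * (1 + δ / 2) with hβ
  have hβα : α < β := by rw [hβ]; nlinarith
  have hβ0 : 0 < β := hα0.trans hβα
  obtain ⟨C, hC0, hC⟩ := exists_norm_wordSum_factor_le ha hA1 hlam hA2 hA3 hχ hz.le hβα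
  obtain ⟨C', hC'0, hC'⟩ := exists_norm_integral_twisted_le hs b hω hβ0.le hC0 hC
  obtain ⟨S, hS⟩ := Finite.exists_le s
  have hS0 : 0 < S := (hs (Classical.arbitrary _)).trans_le (hS _)
  have hm0 : (0 : ℝ) < m := by
    have : 0 < m := Fin.pos (Classical.arbitrary (Fin m))
    exact_mod_cast this
  set κ := lam * (1 - δ) with hκ
  have hκ0 : 0 < κ := mul_pos hlam (by linarith)
  have hfreq : ∃ᶠ n : ℕ in atTop, Real.exp ((χ - ε) * n) ≤
      vecNorm (cocycle a (ω • s) n *ᵥ Gam s ω b) := by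
    apply frequently_le_of_lt_expGrowthSup
    rw [← lyapVec_eq_expGrowthSup, hz]
    exact_mod_cast (by linarith : χ - ε < χ)
  have hexp1 : κ * β < χ - ε := by
    have : κ * β = χ * (1 - δ / 2 - δ ^ 2 / 2) := by
      rw [hκ, hβ, ← hαl]; ring
    rw [this]
    have h1 : 0 < χ * δ ^ 2 := by positivity
    nlinarith
  have hexp2 : 2 * (lam + ε) < κ * γ + 2 * (χ - ε) := by
    have : κ * γ = lam * γ - δ * (γ * lam) := by rw [hκ]; ring
    rw [this]
    have h1 : lam * γ + 2 * χ - 2 * lam = gap := by rw [hgap, ← hαl]; ring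
    linarith
  obtain ⟨n, hn, hn1, hn2, W, hW0, hW, hwin⟩ := (hfreq.and_eventually
    ((eventually_const_mul_exp_lt (4 * (C' * 2 ^ β) * m) hexp1).and
    ((eventually_const_mul_exp_lt (4 * S * C₃ * (m ^ 2 * 2 ^ γ)) hexp2).and
    (eventually_exists_window ha hA1 hlam hA2 hε0)))).exists
  -- A letter `c` for which the exponential sum over `ζ^{[n]}(c)` is large.
  obtain ⟨c, hc⟩ : ∃ c, Real.exp ((χ - ε) * n) / m ≤
      ‖wordSum (ω • s) (Gam s ω b) ((prodSub a n).word c)‖ := by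
    by_contra! hall
    have h1 : (vecNorm (cocycle a (ω • s) n *ᵥ Gam s ω b) : ℝ) =
        ∑ c, ‖wordSum (ω • s) (Gam s ω b) ((prodSub a n).word c)‖ := by
      rw [cocycle_mulVec, vecNorm]
      push_cast
      rfl
    have h2 := Finset.sum_lt_sum_of_nonempty (Finset.univ_nonempty (α := Fin m))
      fun c _ => hall c
    rw [← h1, Finset.sum_const, Finset.card_univ, Fintype.card_fin, nsmul_eq_mul,
      mul_div_cancel₀ _ hm0.ne'] at h2
    linarith
  set A := ‖wordSum (ω • s) (Gam s ω b) ((prodSub a n).word c)‖ with hA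
  -- The dyadic scale `L = 2 ^ K` just below `exp (κ n)`.
  obtain ⟨K, hK1, hK2⟩ := exists_nat_pow_near (Real.one_le_exp (x := κ * n) (by positivity))
    (one_lt_two (α := ℝ))
  set L : ℝ := 2 ^ K with hL
  have hL1 : 1 ≤ L := one_le_pow₀ one_le_two
  have hLlow : Real.exp (κ * n) / 2 ≤ L := by
    rw [pow_succ] at hK2
    linarith
  have hLβ : C' * 2 ^ β * L ^ β ≤ C' * 2 ^ β * Real.exp (κ * β * n) := by
    gcongr
    calc L ^ β ≤ Real.exp (κ * n) ^ β := by gcongr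
      _ = Real.exp (κ * β * n) := by rw [← Real.exp_mul]; ring_nf
  have hsmall : 4 * (C' * 2 ^ β * L ^ β) ≤ A := by
    refine le_trans ?_ hc
    rw [le_div_iff₀ hm0]
    nlinarith
  have hlow := le_meanSq hμX hμT hs hS b (L := L) (E := C' * 2 ^ β * L ^ β) hω (by linarith)
    (fun x hx u v hv hvL => by
      refine (hC' x hx u v hv).trans ?_
      rw [mul_assoc, ← Real.mul_rpow zero_le_two (by linarith)]
      gcongr
      linarith)
    ((prodSub a n).word_ne_nil c) (fun x hx => hwin x hx c) hsmall
  rw [meanSq_eq_integral_fejer hμX hμT hs b hσ ω (by linarith)] at hlow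
  have hup := hlow.trans (mul_le_mul_of_nonneg_left (hC₃ K) (by positivity))
  rw [← hL, Real.rpow_sub (by linarith), Real.rpow_two] at hup
  refine absurd hn2 (not_lt.mpr ?_)
  exact exp_le_of_scale_bounds hm0 hS0 (by linarith) hγ0.le (Nat.cast_nonneg W) hc hLlow hup hW

lemma lowerDim_eq [IsProbabilityMeasure μ]
    (ha : ∀ n, (a n).InClass) (hA1 : CondA1' a) (hA2 : CondA2 a lam)
    (hA3 : CondA3 a) (hs : ∀ j, 0 < s j) (hμX : ∀ᵐ x ∂μ, x ∈ space a)
    (hμT : MeasurePreserving (shift 1) μ μ) {b : Fin m → ℂ} {ω : ℝ} (hω : ω ≠ 0)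
    (hpos : 0 < lyap a (ω • s)) (hz : lyapVec a (ω • s) (Gam s ω b) = lyap a (ω • s))
    {σ : Measure ℝ}
    (hσ : IsSpectralMeasure (flow s) (suspensionMeasure a s μ) (simpleCyl b) σ) :
    lowerDim σ ω = 2 - 2 * lyap a (ω • s) / (lam : EReal) := by
  have hne : Nonempty (ℤ → Fin m) := nonempty_of_isProbabilityMeasure μ
  have : Nonempty (Fin m) := hne.map fun x => x 0
  have hle : lyap a (ω • s) ≤ lam := hz ▸ lyapVec_le hA2 _ _
  have hlam : 0 < lam := by exact_mod_cast hpos.trans_le hle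
  obtain ⟨χ, hχ⟩ : ∃ χ : ℝ, lyap a (ω • s) = χ :=
    ⟨(lyap a (ω • s)).toReal, (EReal.coe_toReal (hle.trans_lt (EReal.coe_lt_top _)).ne
      (EReal.bot_lt_zero.trans hpos).ne').symm⟩
  rw [hχ] at hpos hz ⊢
  have hχ0 : 0 < χ := by exact_mod_cast hpos
  have hval : (2 - 2 * (χ : EReal) / (lam : EReal)) = ((2 - 2 * χ / lam : ℝ) : EReal) := by
    rw [EReal.coe_sub, EReal.coe_div, EReal.coe_mul]
    rfl
  rw [hval]
  exact le_antisymm (lowerDim_le ha hA1 hlam hA2 hA3 hs hμX hμT hω hχ0 hz hσ)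
    (le_lowerDim ha hA1 hlam hA2 hA3 hs hμX hμT hω hχ0 hz.le hσ)

end LocalDimension

/-! ### Exceptional vectors -/

/-- The multiplier `(1 - exp (-2πi ω s_j)) / (2πi ω)` in `Gam`. -/
def gamCoeff (s : Fin m → ℝ) (ω : ℝ) (j : Fin m) : ℂ :=
  (1 - phase (ω * s j)) / (2 * Real.pi * Complex.I * ω)

lemma Gam_apply {s : Fin m → ℝ} {ω : ℝ} (hω : ω ≠ 0) (b : Fin m → ℂ) (j : Fin m) :
    Gam s ω b j = gamCoeff s ω j * b j := by
  rw [Gam, if_neg hω, gamCoeff, phase_mul_eq_exp]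
  ring

lemma gamCoeff_ne_zero {s : Fin m → ℝ} (hs : ∀ j, 0 < s j) {ω : ℝ} (hω : ω ≠ 0) {j : Fin m}
    (h : ∀ k : ℤ, ω ≠ (s j)⁻¹ * k) : gamCoeff s ω j ≠ 0 := by
  have hc : (2 * Real.pi * Complex.I * ω : ℂ) ≠ 0 := by simp [hω, Real.pi_ne_zero]
  refine div_ne_zero (fun h0 => ?_) hc
  have h1 : phase (ω * s j) = 1 := (sub_eq_zero.mp h0).symm
  rw [phase, Complex.exp_eq_one_iff] at h1
  obtain ⟨n, hn⟩ := h1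
  have hpi : (2 * Real.pi * Complex.I : ℂ) ≠ 0 := by simp [Real.pi_ne_zero]
  have h2 : ((ω * s j : ℝ) : ℂ) = ((-n : ℤ) : ℂ) := by
    refine mul_left_cancel₀ hpi ?_
    push_cast at hn ⊢
    linear_combination -hn
  have h3 : ω * s j = ((-n : ℤ) : ℝ) := by exact_mod_cast h2
  refine h (-n) ?_
  rw [← h3]
  field_simp [(hs j).ne']

lemma lyapVec_sub_lt {a : ℕ → Substitution m} {ξ : Fin m → ℝ} {z w : Fin m → ℂ} {c : EReal}
    (hz : lyapVec a ξ z < c) (hw : lyapVec a ξ w < c) : lyapVec a ξ (z - w) < c := by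
  rw [sub_eq_add_neg, ← neg_one_smul ℂ w]
  exact (lyapVec_add_le a ξ _ _).trans_lt
    (max_lt hz ((lyapVec_smul_le a ξ _ _).trans_lt hw))

/-- Two exceptional values of `c` would make the direction of `e_j` exceptional. -/
lemma encard_exceptional_le_one {a : ℕ → Substitution m} {s : Fin m → ℝ} {ω : ℝ} (hω : ω ≠ 0)
    {j : Fin m} (hj : gamCoeff s ω j ≠ 0)
    (hmax : lyapVec a (ω • s) (Pi.single j 1) = lyap a (ω • s)) (b : Fin m → ℂ) :
    {c : ℂ | lyapVec a (ω • s) (Gam s ω (b + c • Pi.single j 1)) < lyap a (ω • s)}.encard ≤ 1 := by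
  rw [Set.encard_le_one_iff]
  intro c d hc hd
  by_contra hcd
  have h1 : Gam s ω (b + c • Pi.single j 1) - Gam s ω (b + d • Pi.single j 1) =
      ((c - d) * gamCoeff s ω j) • (Pi.single j 1 : Fin m → ℂ) := by
    ext i
    simp only [Pi.sub_apply, Gam_apply hω, Pi.add_apply, Pi.smul_apply, smul_eq_mul]
    rcases eq_or_ne i j with rfl | hij
    · simp only [Pi.single_eq_same]; ring
    · simp [Pi.single_eq_of_ne hij]
  have h2 := lyapVec_sub_lt hc hd
  rw [h1] at h2
  have h3 : (c - d) * gamCoeff s ω j ≠ 0 := mul_ne_zero (sub_ne_zero.mpr hcd) hj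
  have h4 := (lyapVec_smul_le a (ω • s) ((c - d) * gamCoeff s ω j)⁻¹ _).trans_lt h2
  rw [smul_smul, inv_mul_cancel₀ h3, one_smul, hmax] at h4
  exact lt_irrefl _ h4

/-- For fixed `ω`, the exceptional vectors form a proper subspace (or the empty set), which is a
null set. -/
lemma ae_not_exceptional [Nonempty (Fin m)] (a : ℕ → Substitution m) {s : Fin m → ℝ} {ω : ℝ}
    (hω : ω ≠ 0) (h : ∀ j, gamCoeff s ω j ≠ 0) :
    ∀ᵐ b : Fin m → ℂ, ¬ lyapVec a (ω • s) (Gam s ω b) < lyap a (ω • s) := by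
  rcases eq_or_ne (lyap a (ω • s)) ⊥ with hbot | hbot
  · exact Eventually.of_forall fun b => by rw [hbot]; exact not_lt_bot
  obtain ⟨j, hj⟩ := exists_lyapVec_single_eq_lyap a (ω • s)
  have hadd : ∀ b c : Fin m → ℂ, Gam s ω (b + c) = Gam s ω b + Gam s ω c := by
    intro b c
    ext i
    simp only [Pi.add_apply, Gam_apply hω]
    ring
  have hsmul : ∀ (r : ℂ) (b : Fin m → ℂ), Gam s ω (r • b) = r • Gam s ω b := by
    intro r b
    ext i
    simp only [Pi.smul_apply, Gam_apply hω, smul_eq_mul]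
    ring
  let V : Submodule ℝ (Fin m → ℂ) :=
    { carrier := {b | lyapVec a (ω • s) (Gam s ω b) < lyap a (ω • s)}
      zero_mem' := by
        have h0 : Gam s ω 0 = 0 := by
          ext i
          simp [Gam_apply hω]
        rw [Set.mem_ofPred_eq, h0, lyapVec_zero]
        exact bot_lt_iff_ne_bot.mpr hbot
      add_mem' := fun {b c} hb hc => by
        rw [Set.mem_ofPred_eq, hadd]
        exact (lyapVec_add_le _ _ _ _).trans_lt (max_lt hb hc)
      smul_mem' := fun r b hb => by
        have h1 : r • b = (r : ℂ) • b := by ext i; simp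
        rw [Set.mem_ofPred_eq, h1, hsmul]
        exact (lyapVec_smul_le _ _ _ _).trans_lt hb }
  have hV : V ≠ ⊤ := by
    intro htop
    have h1 : (gamCoeff s ω j)⁻¹ • (Pi.single j 1 : Fin m → ℂ) ∈ V := htop ▸ Submodule.mem_top
    have h2 : Gam s ω ((gamCoeff s ω j)⁻¹ • (Pi.single j 1 : Fin m → ℂ)) = Pi.single j 1 := by
      rw [hsmul]
      ext i
      simp only [Pi.smul_apply, Gam_apply hω, smul_eq_mul]
      rcases eq_or_ne i j with rfl | hij
      · simp [h i]
      · simp [Pi.single_eq_of_ne hij]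
    have h3 : lyapVec a (ω • s) (Gam s ω ((gamCoeff s ω j)⁻¹ • (Pi.single j 1 : Fin m → ℂ))) <
        lyap a (ω • s) := h1
    rw [h2, hj] at h3
    exact lt_irrefl _ h3
  rw [ae_iff]
  simp only [not_not]
  exact Measure.addHaar_submodule volume V hV

/-! ### Measurability in the frequency and the vector -/

lemma continuous_spectralMat (ζ : Substitution m) : Continuous ζ.spectralMat := by
  refine continuous_matrix fun b c => ?_
  simp only [Substitution.spectralMat, Matrix.of_apply]
  refine continuous_finsetSum _ fun j _ => ?_
  split_ifs
  · have h : ∀ v : List (Fin m), Continuous fun ξ : Fin m → ℝ => (v.map ξ).sum := by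
      intro v
      induction v with
      | nil => simpa using continuous_const
      | cons c v ih => exact (continuous_apply c).add ih
    exact continuous_phase.comp (h _)
  · exact continuous_const

lemma continuous_cocycle (a : ℕ → Substitution m) (n : ℕ) :
    Continuous fun ξ => cocycle a ξ n := by
  induction n with
  | zero => exact continuous_const
  | succ n ih =>
    refine Continuous.matrix_mul ((continuous_spectralMat _).comp ?_) ih
    exact continuous_const.matrix_mulVec continuous_id

lemma measurable_expGrowthSup {X : Type*} [MeasurableSpace X] {u : ℕ → X → ℝ≥0}
    (hu : ∀ n, Measurable (u n)) :
    Measurable fun x => ExpGrowth.expGrowthSup fun n => (u n x : ℝ≥0∞) := by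
  refine Measurable.limsup fun n => ?_
  simp only [div_eq_mul_inv]
  exact (ENNReal.measurable_log.comp (hu n).coe_nnreal_ennreal).mul_const _

lemma measurable_Gam (s : Fin m → ℝ) :
    Measurable fun p : (Fin m → ℂ) × ℝ => Gam s p.2 p.1 := by
  refine measurable_pi_lambda _ fun j => ?_
  unfold Gam
  refine Measurable.ite (measurable_snd (measurableSet_singleton 0)) (by fun_prop) ?_
  fun_prop

lemma measurableSet_exceptional (a : ℕ → Substitution m) (s : Fin m → ℝ) :
    MeasurableSet {p : (Fin m → ℂ) × ℝ |
      lyapVec a (p.2 • s) (Gam s p.2 p.1) < lyap a (p.2 • s)} := by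
  have hc : ∀ n, Continuous fun p : (Fin m → ℂ) × ℝ => cocycle a (p.2 • s) n := fun n =>
    (continuous_cocycle a n).comp (continuous_snd.smul continuous_const)
  have hcoc : ∀ n i j, Measurable fun p : (Fin m → ℂ) × ℝ => cocycle a (p.2 • s) n i j :=
    fun n i j => ((hc n).matrix_elem i j).measurable
  refine measurableSet_lt (measurable_expGrowthSup fun n => ?_)
    (measurable_expGrowthSup fun n => ?_)
  · unfold vecNorm
    refine Finset.measurable_fun_sum _ fun i _ => Measurable.nnnorm ?_
    simp only [Matrix.mulVec, dotProduct]
    exact Finset.measurable_fun_sum _ fun j _ =>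
      (hcoc n i j).mul ((measurable_pi_apply j).comp (measurable_Gam s))
  · unfold matNorm
    refine (Continuous.finset_sup_apply fun j _ => ?_).measurable
    exact continuous_finsetSum _ fun i _ => ((hc n).matrix_elem i j).nnnorm

/-- By Fubini's theorem, almost every vector is exceptional only for a null set of frequencies. -/
lemma ae_ae_not_exceptional [Nonempty (Fin m)] (a : ℕ → Substitution m) {s : Fin m → ℝ}
    (hs : ∀ j, 0 < s j) :
    ∀ᵐ b : Fin m → ℂ, ∀ᵐ ω : ℝ, ω ≠ 0 ∧
      ¬ lyapVec a (ω • s) (Gam s ω b) < lyap a (ω • s) := by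
  have hres : ∀ᵐ ω : ℝ, ∀ (j : Fin m) (k : ℤ), ω ≠ (s j)⁻¹ * k := by
    rw [ae_all_iff]
    intro j
    rw [ae_all_iff]
    exact fun k => Measure.ae_ne volume _
  have h0 : ∀ᵐ ω : ℝ, ω ≠ 0 := Measure.ae_ne volume 0
  have h1 : ∀ᵐ ω : ℝ, ∀ᵐ b : Fin m → ℂ,
      ¬ lyapVec a (ω • s) (Gam s ω b) < lyap a (ω • s) := by
    filter_upwards [hres, h0] with ω hω hω0
    exact ae_not_exceptional a hω0 fun j => gamCoeff_ne_zero hs hω0 (hω j)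
  have h2 := (Measure.ae_ae_comm (μ := (volume : Measure (Fin m → ℂ)))
    (ν := (volume : Measure ℝ)) (measurableSet_exceptional a s).compl).mpr h1
  filter_upwards [h2] with b hb
  filter_upwards [h0, hb] with ω hω hωb
  exact ⟨hω, hωb⟩

end SAdic
end

theorem corollary4p3 {m : ℕ} (a : ℕ → Substitution m) (ha : ∀ n, (a n).InClass)
    (hA1 : CondA1' a) (lam : ℝ) (hA2 : CondA2 a lam) (hA3 : CondA3 a)
    (haper : Aperiodic a) (hrec : Recognizable a)
    (s : Fin m → ℝ) (hs : ∀ j, 0 < s j)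
    (μ : Measure (ℤ → Fin m)) (hμ : IsProbabilityMeasure μ) (hμX : ∀ᵐ x ∂μ, x ∈ space a)
    (hμT : MeasurePreserving (shift 1) μ μ) :
    (∀ ω : ℝ, (∀ (j : Fin m) (k : ℤ), ω ≠ (s j)⁻¹ * k) → ∀ b : Fin m → ℂ,
      ∃ j : Fin m, ∃ E : Set ℂ,
        E = {c : ℂ | lyapVec a (ω • s) (Gam s ω (b + c • Pi.single j 1)) < lyap a (ω • s)} ∧
        E.encard ≤ 1 ∧
        (0 < lyap a (ω • s) → ∀ c : ℂ, c ∉ E → ∀ σ : Measure ℝ,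
          IsSpectralMeasure (flow s) (suspensionMeasure a s μ)
            (simpleCyl (b + c • Pi.single j 1)) σ →
          lowerDim σ ω = 2 - 2 * lyap a (ω • s) / (lam : EReal))) ∧
    (∀ᵐ b : Fin m → ℂ, ∀ σ : Measure ℝ,
      IsSpectralMeasure (flow s) (suspensionMeasure a s μ) (simpleCyl b) σ →
      ∀ᵐ ω : ℝ, 0 < lyap a (ω • s) →
        lowerDim σ ω = 2 - 2 * lyap a (ω • s) / (lam : EReal)) := by
  have hne : Nonempty (ℤ → Fin m) := nonempty_of_isProbabilityMeasure μ
  have : Nonempty (Fin m) := hne.map fun x => x 0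
  refine ⟨fun ω hω b => ?_, ?_⟩
  · have hω0 : ω ≠ 0 := by simpa using hω (Classical.arbitrary _) 0
    obtain ⟨j, hj⟩ := exists_lyapVec_single_eq_lyap a (ω • s)
    refine ⟨j, _, rfl, encard_exceptional_le_one hω0 (gamCoeff_ne_zero hs hω0 (hω j)) hj b,
      fun hpos c hc σ hσ => ?_⟩
    exact lowerDim_eq ha hA1 hA2 hA3 hs hμX hμT hω0 hpos
      (le_antisymm (lyapVec_le_lyap _ _ _) (not_lt.mp hc)) hσ
  · filter_upwards [ae_ae_not_exceptional a hs] with b hb σ hσ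
    filter_upwards [hb] with ω hω hpos
    exact lowerDim_eq ha hA1 hA2 hA3 hs hμX hμT hω.1 hpos
      (le_antisymm (lyapVec_le_lyap _ _ _) (not_lt.mp hω.2)) hσ
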